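/- Let $I\subset\mathbb R$ be an open interval and $f:I\to(0,\infty)$ a smooth function that is not constant. Let $\mathbb S^3=\{(z,w)\in\mathbb C^2:|z|^2+|w|^2=1\}$ with its standard metric $g_3$, and let $\overline M=I\times_f\mathbb S^3$ be the Lorentzian warped product $I\times\mathbb S^3$ with metric $\bar g=-dt^2+f(t)^2g_3$. Let $\mathbb S^2(1/2)=\{(z,x)\in\mathbb C\times\mathbb R:|z|^2+x^2=1/4\}$ and let $\pi:\mathbb S^3\to\mathbb S^2(1/2)$, $\pi(z,w)=\big(z\bar w,\tfrac12|z|^2-\tfrac12|w|^2\big)$, be the Hopf map. For $t_0\in I$ and a circle $C\subset\mathbb S^2(1/2)$, the Hopf lift of $C$ at the level $t_0$ is $\{t_0\}\times\pi^{-1}(C)\subset\overline M$. A spacelike surface $\phi:S\to\overline M$ with mean curvature vector $\vec H_\phi=\frac12\operatorname{trace}h_\phi$ (with $h_\phi$ the second fundamental form) is called trapped if $\bar g(\vec H_\phi,\vec H_\phi)<0$ everywhere, marginally trapped if $\bar g(\vec H_\phi,\vec H_\phi)=0$ and $\vec H_\phi\neq0$ everywhere, and untrapped if $\bar g(\vec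 H_\phi,\vec H_\phi)>0$ everywhere. **Proposition.** There is a level $t_0\in I$ with $f'(t_0)\neq0$, and for every $c\in\mathbb R$ there is a circle in $\mathbb S^2(1/2)$ of constant geodesic curvature $c$. Let $t_0\in I$ be any level with $f'(t_0)\ne0$, let $C$ be any circle in $\mathbb S^2(1/2)$ (the image of a unit speed curve defined on $\mathbb R$) of constant geodesic curvature $c$, and let $T=\{t_0\}\times\pi^{-1}(C)$. 1. If $c=2|f'(t_0)|$, then $T$ is the image of a smooth embedding $\phi:\mathbb S^1\times\mathbb S^1\to\overline M$ that is marginally trapped. 2. If $c>2|f'(t_0)|$, then $T$ is the image of a smooth embedding $\phi:\mathbb S^1\times\mathbb S^1\to\overline M$ that is untrapped. 3. If $|f'(t_0)|<c<2|f'(t_0)|$, then $T$ is the image of a smooth embedding $\phi:\mathbb S^1\times\mathbb S^1\to\overline M$ that is trapped. For each of the three kinds there are infinitely many (pairwise distinct as subsets of $\overline M$) embedded tori of that kind of the form described in 1, 2 and 3, respectively. In particular $\overline M$ contains infinitely many embedded trapped tori, infinitely many embedded marginally trapped tori, and infinitely many embedded untrapped tori. -/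

import Mathlib

open scoped Manifold ContDiff InnerProductSpace
open Set Metric

noncomputable section

/-! ### Semi-Riemannian metrics, Levi-Civita connection, mean curvature vector -/

section SemiRiemannian

variable {E : Type*} [NormedAddCommGroup E] [NormedSpace ℝ E]
  {H : Type*} [TopologicalSpace H] (I : ModelWithCorners ℝ E H)
  {M : Type*} [TopologicalSpace M] [ChartedSpace H M]

/-- The coordinate expression, in the preferred chart at `x₀`, of a field `B` of bilinear forms on
the tangent spaces of a (boundaryless) manifold: at the point `y` of the chart domain in `E` it is
the pull-back of `B` under the inverse of the chart. -/
def coordTensor (B : ∀ x : M, TangentSpace I x →L[ℝ] TangentSpace I x →L[ℝ] ℝ) (x₀ : M) (y : E) :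
    E →L[ℝ] E →L[ℝ] ℝ :=
  let D : E →L[ℝ] E := mfderiv 𝓘(ℝ, E) I (extChartAt I x₀).symm y
  let b : E →L[ℝ] E →L[ℝ] ℝ := B ((extChartAt I x₀).symm y)
  b.bilinearComp D D

theorem mdifferentiableAt_symm_of_mem [IsManifold I 1 M] [I.Boundaryless] {x₀ : M} {y : E}
    (hy : y ∈ (extChartAt I x₀).target) :
    MDifferentiableAt 𝓘(ℝ, E) I (extChartAt I x₀).symm y := by
  have h := mdifferentiableWithinAt_extChartAt_symm hy
  rwa [I.range_eq_univ, mdifferentiableWithinAt_univ] at h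

variable (M) in
/-- A smooth semi-Riemannian metric on a (boundaryless) smooth manifold: a smooth field of
nondegenerate symmetric bilinear forms on the tangent spaces. -/
structure SemiRiemannianMetric where
  /-- the scalar product on each tangent space -/
  val : ∀ x : M, TangentSpace I x →L[ℝ] TangentSpace I x →L[ℝ] ℝ
  symm : ∀ x v w, val x v w = val x w v
  nondegenerate : ∀ x v, (∀ w, val x v w = 0) → v = 0
  smooth : ∀ x₀, ContDiffOn ℝ ∞ (coordTensor I val x₀) (extChartAt I x₀).target

namespace SemiRiemannianMetric

variable {I} [FiniteDimensional ℝ E]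

/-- The musical isomorphism `T_xM ≃ (T_xM)*`, `v ↦ g_x(v, ·)`. -/
def flat (g : SemiRiemannianMetric I M) (x : M) : E ≃ₗ[ℝ] (E →L[ℝ] ℝ) :=
  LinearEquiv.ofBijective (g.val x : E →L[ℝ] E →L[ℝ] ℝ).toLinearMap (by
    have hinj : Function.Injective (g.val x : E →L[ℝ] E →L[ℝ] ℝ).toLinearMap := by
      rw [← LinearMap.ker_eq_bot, LinearMap.ker_eq_bot']
      intro v hv
      exact g.nondegenerate x v fun w => DFunLike.congr_fun hv w
    have hdim : Module.finrank ℝ E = Module.finrank ℝ (E →L[ℝ] ℝ) := by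
      rw [← (LinearMap.toContinuousLinearMap (𝕜 := ℝ) (E := E) (F' := ℝ)).finrank_eq]
      exact (Subspace.dual_finrank_eq (K := ℝ) (V := E)).symm
    exact ⟨hinj, (LinearMap.injective_iff_surjective_of_finrank_eq_finrank hdim).1 hinj⟩)

/-- The Christoffel symbols of the Levi-Civita connection of `g` at `x₀`, in the preferred chart
at `x₀`: `Γ(u, v) = ∑ Γᵏᵢⱼ uⁱ vʲ ∂ₖ` is determined by
`g(Γ(u, v), w) = (∂ᵤ g(v, w) + ∂ᵥ g(u, w) - ∂_w g(u, v)) / 2`. -/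
def christoffel (g : SemiRiemannianMetric I M) (x₀ : M) (u v : E) : E :=
  let dg : E →L[ℝ] E →L[ℝ] E →L[ℝ] ℝ :=
    fderiv ℝ (coordTensor I g.val x₀) (extChartAt I x₀ x₀)
  (g.flat x₀).symm ((1 / 2 : ℝ) • (dg u v + dg v u - (dg.flip u).flip v))

variable {E' : Type*} [NormedAddCommGroup E'] [NormedSpace ℝ E']
  {H' : Type*} [TopologicalSpace H'] (J : ModelWithCorners ℝ E' H')
  {S : Type*} [TopologicalSpace S] [ChartedSpace H' S]

/-- The covariant derivative `∇_X (dφ Y)` at `φ p`, for the Levi-Civita connection of `g` along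
the map `φ : S → M`, where `Y` is extended with constant components in the chart at `p`:
`∂ᵢ∂ⱼφᵏ + Γᵏ(∂ᵢφ, ∂ⱼφ)` in the charts at `p` and at `φ p`. Its normal part does not depend on the
extension of `Y`. -/
def covDerivAlong (g : SemiRiemannianMetric I M) (φ : S → M) (p : S) (X Y : TangentSpace J p) :
    TangentSpace I (φ p) :=
  (fderiv ℝ (fderiv ℝ (writtenInExtChartAt J I p φ)) (extChartAt J p p) X Y : E) +
    g.christoffel (φ p) (mfderiv J I φ p X) (mfderiv J I φ p Y)

/-- `φ` is spacelike: the induced metric is positive definite on every tangent space. -/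
def IsSpacelike (g : SemiRiemannianMetric I M) (φ : S → M) : Prop :=
  ∀ p : S, ∀ X : TangentSpace J p, X ≠ 0 →
    0 < g.val (φ p) (mfderiv J I φ p X) (mfderiv J I φ p X)

/-- `e` is an orthonormal basis of `T_pS` for the metric induced by the spacelike map `φ` on the
surface `S`. -/
def IsOrthonormalFrame (g : SemiRiemannianMetric I M) (φ : S → M) (p : S)
    (e : Module.Basis (Fin 2) ℝ (TangentSpace J p)) : Prop :=
  ∀ i j, g.val (φ p) (mfderiv J I φ p (e i)) (mfderiv J I φ p (e j)) = if i = j then 1 else 0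

/-- The component of `v ∈ T_{φ p}M` orthogonal to `dφ(T_pS)`, computed with an orthonormal basis
`e` of `T_pS`. -/
def normalPart (g : SemiRiemannianMetric I M) (φ : S → M) (p : S)
    (e : Module.Basis (Fin 2) ℝ (TangentSpace J p)) (v : TangentSpace I (φ p)) :
    TangentSpace I (φ p) :=
  v - ∑ i, g.val (φ p) v (mfderiv J I φ p (e i)) • mfderiv J I φ p (e i)

/-- `Hv` is the mean curvature vector of the spacelike surface `φ` at `p`: one half of the trace of
the second fundamental form `h(X, Y) = (∇_X dφ Y)^⊥`, the trace being computed in an orthonormal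
basis of `T_pS`. -/
def IsMeanCurvatureVector (g : SemiRiemannianMetric I M) (φ : S → M) (p : S)
    (Hv : TangentSpace I (φ p)) : Prop :=
  ∃ e : Module.Basis (Fin 2) ℝ (TangentSpace J p), g.IsOrthonormalFrame J φ p e ∧
    Hv = (1 / 2 : ℝ) • ∑ i, g.normalPart J φ p e (g.covDerivAlong J φ p (e i) (e i))

/-- Trapped: spacelike, with everywhere timelike mean curvature vector. -/
def IsTrapped (g : SemiRiemannianMetric I M) (φ : S → M) : Prop :=
  g.IsSpacelike J φ ∧ ∀ p, ∃ Hv, g.IsMeanCurvatureVector J φ p Hv ∧ g.val (φ p) Hv Hv < 0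

/-- Marginally trapped: spacelike, with everywhere null (lightlike and nonzero) mean curvature
vector. -/
def IsMarginallyTrapped (g : SemiRiemannianMetric I M) (φ : S → M) : Prop :=
  g.IsSpacelike J φ ∧
    ∀ p, ∃ Hv, g.IsMeanCurvatureVector J φ p Hv ∧ g.val (φ p) Hv Hv = 0 ∧ Hv ≠ 0

/-- Untrapped: spacelike, with everywhere (nonzero) spacelike mean curvature vector. -/
def IsUntrapped (g : SemiRiemannianMetric I M) (φ : S → M) : Prop :=
  g.IsSpacelike J φ ∧ ∀ p, ∃ Hv, g.IsMeanCurvatureVector J φ p Hv ∧ 0 < g.val (φ p) Hv Hv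

end SemiRiemannianMetric

end SemiRiemannian

/-! ### The round metric of the unit sphere -/

section Round

variable {V : Type*} [NormedAddCommGroup V] [InnerProductSpace ℝ V] {n : ℕ}
  [Fact (Module.finrank ℝ V = n + 1)]

/-- The differential at `p` of the inclusion of the unit sphere. -/
def sphereInclDeriv (p : sphere (0 : V) 1) : EuclideanSpace ℝ (Fin n) →L[ℝ] V :=
  mfderiv (𝓡 n) 𝓘(ℝ, V) (fun q : sphere (0 : V) 1 => (q : V)) p

/-- The standard scalar product on the tangent space at `p` of the unit sphere of `V`. -/
def roundVal (p : sphere (0 : V) 1) :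
    EuclideanSpace ℝ (Fin n) →L[ℝ] EuclideanSpace ℝ (Fin n) →L[ℝ] ℝ :=
  (innerSL ℝ).bilinearComp (sphereInclDeriv p) (sphereInclDeriv p)

/-- The standard Riemannian metric of the unit sphere of `V`. -/
def roundMetric : SemiRiemannianMetric (𝓡 n) (sphere (0 : V) 1) where
  val p := roundVal p
  symm p v w := real_inner_comm _ _
  nondegenerate p v h := by
    have h1 : ⟪sphereInclDeriv p v, sphereInclDeriv p v⟫_ℝ = 0 := h v
    rw [inner_self_eq_zero] at h1
    exact injective_mvfderiv_subtypeVal_sphere p (h1.trans (map_zero (sphereInclDeriv p)).symm)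
  smooth x₀ := by
    have key : ∀ y ∈ (extChartAt (𝓡 n) x₀).target,
        coordTensor (𝓡 n) (fun p : sphere (0 : V) 1 => roundVal p) x₀ y =
          (innerSL ℝ).bilinearComp
            (fderiv ℝ (fun z => ((extChartAt (𝓡 n) x₀).symm z : V)) y)
            (fderiv ℝ (fun z => ((extChartAt (𝓡 n) x₀).symm z : V)) y) := by
      intro y hy
      have h1 : MDifferentiableAt 𝓘(ℝ, EuclideanSpace ℝ (Fin n)) (𝓡 n)
          (extChartAt (𝓡 n) x₀).symm y :=
        mdifferentiableAt_symm_of_mem _ hy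
      have h2 : MDifferentiableAt (𝓡 n) 𝓘(ℝ, V) (fun q : sphere (0 : V) 1 => (q : V))
          ((extChartAt (𝓡 n) x₀).symm y) :=
        (contMDiff_coe_sphere (m := 1) (n := n)).mdifferentiable one_ne_zero _
      have h3 := mfderiv_comp y h2 h1
      rw [mfderiv_eq_fderiv] at h3
      ext u v
      have hu := DFunLike.congr_fun h3 u
      have hv := DFunLike.congr_fun h3 v
      exact (congrArg₂ (fun a b : V => ⟪a, b⟫_ℝ) hu hv).symm
    have hC : ContDiffOn ℝ ∞ (fun z => ((extChartAt (𝓡 n) x₀).symm z : V))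
        (extChartAt (𝓡 n) x₀).target := by
      rw [← contMDiffOn_iff_contDiffOn]
      exact (contMDiff_coe_sphere (m := ∞) (n := n)).comp_contMDiffOn
        (contMDiffOn_extChartAt_symm x₀)
    have hD := hC.fderiv_of_isOpen (m := ∞) (isOpen_extChartAt_target x₀) (by simp)
    refine ContDiffOn.congr ?_ key
    rw [contDiffOn_clm_apply]
    intro u
    rw [contDiffOn_clm_apply]
    intro v
    exact (hD.clm_apply contDiffOn_const).inner ℝ (hD.clm_apply contDiffOn_const)

end Round

/-! ### Warped products -/

section Warped

variable {E : Type*} [NormedAddCommGroup E] [NormedSpace ℝ E] [FiniteDimensional ℝ E]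
  {H : Type*} [TopologicalSpace H] {I : ModelWithCorners ℝ E H}
  {M : Type*} [TopologicalSpace M] [ChartedSpace H M]

/-- The scalar product `-dt² + f(t)² g` on the tangent space `ℝ × T_xM` of `U × M` at
`q = (t, x)`. -/
def warpedVal (U : TopologicalSpace.Opens ℝ) (f : ℝ → ℝ) (g : SemiRiemannianMetric I M)
    (q : U × M) : (ℝ × E) →L[ℝ] (ℝ × E) →L[ℝ] ℝ :=
  let gx : E →L[ℝ] E →L[ℝ] ℝ := g.val q.2
  (f q.1) ^ 2 • gx.bilinearComp (.snd ℝ ℝ E) (.snd ℝ ℝ E) -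
    (ContinuousLinearMap.mul ℝ ℝ).bilinearComp (.fst ℝ ℝ E) (.fst ℝ ℝ E)

/-- The warped product metric `-dt² + f(t)² g` on `U × M`, where `U ⊆ ℝ` is open. -/
def warpedMetric (U : TopologicalSpace.Opens ℝ) (f : ℝ → ℝ) (hf : ContDiffOn ℝ ∞ f U)
    (hpos : ∀ t ∈ U, 0 < f t) [IsManifold I 1 M] [I.Boundaryless]
    (g : SemiRiemannianMetric I M) :
    SemiRiemannianMetric (𝓘(ℝ, ℝ).prod I) (U × M) where
  val q := warpedVal U f g q
  symm q v w := by
    have := g.symm q.2 v.2 w.2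
    change f q.1 ^ 2 * g.val q.2 v.2 w.2 - v.1 * w.1 = f q.1 ^ 2 * g.val q.2 w.2 v.2 - w.1 * v.1
    rw [this, mul_comm v.1]
  nondegenerate q v h := by
    have h' : ∀ w : ℝ × E, f q.1 ^ 2 * g.val q.2 v.2 w.2 - v.1 * w.1 = 0 := h
    refine Prod.ext ?_ (g.nondegenerate q.2 v.2 fun w => ?_)
    · have := h' (1, 0)
      have h0 : g.val q.2 v.2 0 = 0 := map_zero _
      change f q.1 ^ 2 * g.val q.2 v.2 0 - v.1 * 1 = 0 at this
      rw [h0] at this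
      change v.1 = (0 : ℝ)
      linarith
    · have := h' (0, w)
      have hne := (hpos q.1 q.1.2).ne'
      simpa [hne] using this
  smooth x₀ := by
    have hid : ∀ y ∈ (extChartAt 𝓘(ℝ, ℝ) x₀.1).target,
        (((extChartAt 𝓘(ℝ, ℝ) x₀.1).symm y : U) : ℝ) = y := fun y hy =>
      (extChartAt 𝓘(ℝ, ℝ) x₀.1).right_inv hy
    have hd : ∀ y ∈ (extChartAt 𝓘(ℝ, ℝ) x₀.1).target,
        HasMFDerivAt 𝓘(ℝ, ℝ) 𝓘(ℝ, ℝ) (extChartAt 𝓘(ℝ, ℝ) x₀.1).symm y (.id ℝ ℝ) := by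
      intro y hy
      refine ⟨(mdifferentiableAt_symm_of_mem 𝓘(ℝ, ℝ) hy).continuousAt, ?_⟩
      refine ((hasFDerivAt_id (𝕜 := ℝ) y).congr_of_eventuallyEq ?_).hasFDerivWithinAt
      filter_upwards [(isOpen_extChartAt_target (I := 𝓘(ℝ, ℝ)) x₀.1).mem_nhds hy] with z hz
      exact hid z hz
    have key : ∀ y ∈ (extChartAt (𝓘(ℝ, ℝ).prod I) x₀).target, ∀ v w : ℝ × E,
        coordTensor (𝓘(ℝ, ℝ).prod I) (fun q : U × M => warpedVal U f g q) x₀ y v w =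
          f y.1 ^ 2 * coordTensor I g.val x₀.2 y.2 v.2 w.2 - v.1 * w.1 := by
      intro y hy v w
      rw [extChartAt_prod] at hy
      have h2 := (mdifferentiableAt_symm_of_mem I hy.2).hasMFDerivAt
      have h3 := ((hd y.1 hy.1).prodMap h2).mfderiv
      have h4 : ∀ u : ℝ × E,
          (mfderiv 𝓘(ℝ, ℝ × E) (𝓘(ℝ, ℝ).prod I)
            (extChartAt (𝓘(ℝ, ℝ).prod I) x₀).symm y : (ℝ × E) →L[ℝ] (ℝ × E)) u =
          (u.1, (mfderiv 𝓘(ℝ, E) I (extChartAt I x₀.2).symm y.2 : E →L[ℝ] E) u.2) := by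
        intro u
        rw [(hd y.1 hy.1).mfderiv] at h3
        rw [extChartAt_prod, modelWithCornersSelf_prod, ← chartedSpaceSelf_prod]
        exact DFunLike.congr_fun h3 u
      have h5 : (extChartAt (𝓘(ℝ, ℝ).prod I) x₀).symm y =
          ((extChartAt 𝓘(ℝ, ℝ) x₀.1).symm y.1, (extChartAt I x₀.2).symm y.2) := by
        rw [extChartAt_prod]; rfl
      change warpedVal U f g ((extChartAt (𝓘(ℝ, ℝ).prod I) x₀).symm y)
        ((mfderiv 𝓘(ℝ, ℝ × E) (𝓘(ℝ, ℝ).prod I)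
            (extChartAt (𝓘(ℝ, ℝ).prod I) x₀).symm y : (ℝ × E) →L[ℝ] (ℝ × E)) v)
        ((mfderiv 𝓘(ℝ, ℝ × E) (𝓘(ℝ, ℝ).prod I)
            (extChartAt (𝓘(ℝ, ℝ).prod I) x₀).symm y : (ℝ × E) →L[ℝ] (ℝ × E)) w) = _
      rw [h4, h4, h5]
      change f ((extChartAt 𝓘(ℝ, ℝ) x₀.1).symm y.1 : U) ^ 2 *
        coordTensor I g.val x₀.2 y.2 v.2 w.2 - v.1 * w.1 = _
      rw [hid y.1 hy.1]
    have hmaps : ∀ y ∈ (extChartAt (𝓘(ℝ, ℝ).prod I) x₀).target,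
        y.1 ∈ U ∧ y.2 ∈ (extChartAt I x₀.2).target := by
      intro y hy
      rw [extChartAt_prod] at hy
      refine ⟨?_, hy.2⟩
      rw [← hid y.1 hy.1]
      exact Subtype.coe_prop _
    rw [contDiffOn_clm_apply]
    intro v
    rw [contDiffOn_clm_apply]
    intro w
    refine ContDiffOn.congr ?_ (fun y hy => key y hy v w)
    refine ContDiffOn.sub (ContDiffOn.mul (ContDiffOn.pow ?_ 2) ?_) contDiffOn_const
    · exact hf.comp contDiff_fst.contDiffOn fun y hy => (hmaps y hy).1
    · exact (((g.smooth x₀.2).comp contDiff_snd.contDiffOn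
        fun y hy => (hmaps y hy).2).clm_apply contDiffOn_const).clm_apply contDiffOn_const

end Warped

/-! ### The Hopf map -/

/-- `ℂ²`, as a real Euclidean space of dimension four. -/
abbrev CC : Type := WithLp 2 (ℂ × ℂ)

/-- `ℂ × ℝ`, as a real Euclidean space of dimension three. -/
abbrev CR : Type := WithLp 2 (ℂ × ℝ)

instance finrank_CC : Fact (Module.finrank ℝ CC = 3 + 1) := ⟨by
  rw [(WithLp.linearEquiv 2 ℝ (ℂ × ℂ)).finrank_eq]
  simp [Complex.finrank_real_complex]⟩

/-- The round three-sphere `{(z, w) ∈ ℂ² : |z|² + |w|² = 1}`. -/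
abbrev S3 : Type := sphere (0 : CC) 1

/-- The formula `(z, w) ↦ (z w̄, (|z|² - |w|²) / 2)` of the Hopf map, which maps `S3` onto the
two-sphere `{(z, x) ∈ ℂ × ℝ : |z|² + x² = 1/4}` of radius `1/2`. -/
def hopf (q : S3) : CR :=
  WithLp.toLp 2 ((q : CC).fst * starRingEnd ℂ (q : CC).snd,
    (‖(q : CC).fst‖ ^ 2 - ‖(q : CC).snd‖ ^ 2) / 2)

/-- The vector product of `ℂ × ℝ = ℝ³`. -/
def crossCR (p q : CR) : CR :=
  WithLp.toLp 2 (Complex.I * ((p.snd : ℂ) * q.fst - (q.snd : ℂ) * p.fst),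
    (starRingEnd ℂ p.fst * q.fst).im)

/-- `γ` is a unit speed curve, defined on all of `ℝ`, in the two-sphere of radius `1/2` (with unit
normal `2γ` along `γ`), with constant geodesic curvature `c`: the tangential part `∇_{γ'}γ'` of
`γ''` equals `c n`, where `(γ', n)` is the positive orthonormal frame of the sphere along `γ`. Such
a curve runs through a whole circle, a small circle if `c ≠ 0`. -/
structure IsCircleOfGeodesicCurvature (γ : ℝ → CR) (c : ℝ) : Prop where
  smooth : ContDiff ℝ ∞ γ
  mem_sphere : ∀ s, γ s ∈ sphere (0 : CR) (1 / 2)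
  unit_speed : ∀ s, ‖deriv γ s‖ = 1
  curvature : ∀ s,
    deriv (deriv γ) s - ⟪deriv (deriv γ) s, (2 : ℝ) • γ s⟫_ℝ • ((2 : ℝ) • γ s) =
      c • crossCR ((2 : ℝ) • γ s) (deriv γ s)

/-- The Hopf lift, in the slice at level `t₀`, of a subset `C` of the two-sphere of radius `1/2`:
the union of the Hopf fibres over `C`. -/
def hopfLift {U : TopologicalSpace.Opens ℝ} (t₀ : U) (C : Set CR) : Set (U × S3) :=
  {q | q.1 = t₀ ∧ hopf q.2 ∈ C}

/-- The closed FLRW spacetime metric `-dt² + f(t)² g₃` on `U × S3`, with `g₃` the round metric. -/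
def flrwMetric (U : TopologicalSpace.Opens ℝ) (f : ℝ → ℝ) (hf : ContDiffOn ℝ ∞ f U)
    (hpos : ∀ t ∈ U, 0 < f t) : SemiRiemannianMetric (𝓘(ℝ, ℝ).prod (𝓡 3)) (U × S3) :=
  warpedMetric U f hf hpos roundMetric

/-- `T` is the image of a smooth embedding `φ` of the torus in `U × S3` which, as an immersed
surface, has the property `P`. -/
def IsEmbeddedTorusWith {U : TopologicalSpace.Opens ℝ} (P : (Circle × Circle → U × S3) → Prop)
    (T : Set (U × S3)) : Prop :=
  ∃ φ : Circle × Circle → U × S3,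
    Manifold.IsSmoothEmbedding ((𝓡 1).prod (𝓡 1)) (𝓘(ℝ, ℝ).prod (𝓡 3)) ∞ φ ∧ range φ = T ∧ P φ

/-- `T` is an embedded trapped torus in the closed FLRW spacetime with metric `g`. -/
def IsTrappedTorus {U : TopologicalSpace.Opens ℝ}
    (g : SemiRiemannianMetric (𝓘(ℝ, ℝ).prod (𝓡 3)) (U × S3)) : Set (U × S3) → Prop :=
  IsEmbeddedTorusWith (g.IsTrapped ((𝓡 1).prod (𝓡 1)))

/-- `T` is an embedded marginally trapped torus in the closed FLRW spacetime with metric `g`. -/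
def IsMarginallyTrappedTorus {U : TopologicalSpace.Opens ℝ}
    (g : SemiRiemannianMetric (𝓘(ℝ, ℝ).prod (𝓡 3)) (U × S3)) : Set (U × S3) → Prop :=
  IsEmbeddedTorusWith (g.IsMarginallyTrapped ((𝓡 1).prod (𝓡 1)))

/-- `T` is an embedded untrapped torus in the closed FLRW spacetime with metric `g`. -/
def IsUntrappedTorus {U : TopologicalSpace.Opens ℝ}
    (g : SemiRiemannianMetric (𝓘(ℝ, ℝ).prod (𝓡 3)) (U × S3)) : Set (U × S3) → Prop :=
  IsEmbeddedTorusWith (g.IsUntrapped ((𝓡 1).prod (𝓡 1)))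

end

/-! After an isometry of `ℂ²` the Hopf lift of a circle becomes a product torus `(u, v) ↦ (r₁ u, r₂
v)`, whose mean curvature in a slice can be computed explicitly.

Put `k = √(4 + c²)`. The Frenet equation makes the axis `A = 2cγ + 4γ × γ'` constant, with `‖A‖ =
k`, and the circle is exactly the part of the two-sphere in the plane `⟪A, p⟫ = c/2`
(`exists_axis`). Take `e` in `S3` over `A / (2k)` and the unitary map sending `(1, 0)` to `e`. It
covers a rotation of the base, so in the resulting coordinates `(a, b)` the lift is `|a|² - |b|² =
c/k`. Together with `|a|² + |b|² = 1` this fixes the moduli: `r₁² = (1 + c/k)/2` and `r₂² = (1 -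
c/k)/2`, whence `r₁r₂ = 1/k` and `(r₁² - r₂²)/(r₁r₂) = c` (`exists_range_sliceTorus_eq`).

The torus at level `t₀` has mean curvature vector `(f'/f) ∂ₜ + (c/(2f²)) n`, with `n` a unit normal
for the round metric, so `g(H, H) = ((c/2)² - f'²)/f²` (`exists_isMeanCurvatureVector_sliceTorus`).
The time component is nonzero because `f'(t₀) ≠ 0`, hence `H` never vanishes, and comparing `c/2`
with `|f'|` gives the three cases. The lower bound on `c` in the trapped case serves only to give `c
≥ 0`.

The connection is defined through charts. For maps into a slice the chart terms recombine into
ordinary derivatives of a map into the ambient Euclidean space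
(`warpedMetric_round_val_covDerivAlong`). The torus is embedded because it is an injective immersion
of a compact space. Infinitely many tori arise because `f'` is nonzero on a nonempty open set of
levels, and lifts at different levels differ. -/

noncomputable section

/-! ### Differentials read in the preferred charts. -/

section ModelDeriv

variable {E : Type*} [NormedAddCommGroup E] [NormedSpace ℝ E]
  {E' : Type*} [NormedAddCommGroup E'] [NormedSpace ℝ E']
  {H : Type*} [TopologicalSpace H] (I : ModelWithCorners ℝ E H)
  {H' : Type*} [TopologicalSpace H'] (J : ModelWithCorners ℝ E' H')
  {M : Type*} [TopologicalSpace M] [ChartedSpace H M]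
  {N : Type*} [TopologicalSpace N] [ChartedSpace H' N]

/-- The differential of a map between manifolds, as a map between the model spaces. -/
def modelDeriv (φ : M → N) (x : M) : E →L[ℝ] E' := mfderiv I J φ x

variable {I J}

/-- The differential of a map is the derivative of its expression in the preferred charts. -/
theorem hasFDerivAt_writtenInExtChartAt [I.Boundaryless]
    {φ : M → N} {x : M} (h : MDifferentiableAt I J φ x) :
    HasFDerivAt (writtenInExtChartAt I J x φ) (modelDeriv I J φ x) (extChartAt I x x) := by
  have h' : HasFDerivWithinAt (writtenInExtChartAt I J x φ) (modelDeriv I J φ x)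
      (range I) (extChartAt I x x) := h.hasMFDerivAt.2
  rwa [I.range_eq_univ, hasFDerivWithinAt_univ] at h'

end ModelDeriv

/-! ### Injective differential implies immersion. -/

section Immersion

/-- An injective linear map between finite-dimensional spaces extends to a linear equivalence
defined on the product with a given space of complementary dimension. -/
theorem exists_equiv_prod_of_injective {E E' F : Type*} [NormedAddCommGroup E] [NormedSpace ℝ E]
    [FiniteDimensional ℝ E] [NormedAddCommGroup E'] [NormedSpace ℝ E'] [FiniteDimensional ℝ E']
    [NormedAddCommGroup F] [NormedSpace ℝ F] [FiniteDimensional ℝ F]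
    (L : E →L[ℝ] E') (hL : Function.Injective L)
    (hdim : Module.finrank ℝ E + Module.finrank ℝ F = Module.finrank ℝ E') :
    ∃ (k : F →L[ℝ] E') (e : (E × F) ≃L[ℝ] E'), (e : (E × F) →L[ℝ] E') = L.coprod k := by
  obtain ⟨q, hq⟩ := Submodule.exists_isCompl L.range
  have hr : Module.finrank ℝ L.range = Module.finrank ℝ E :=
    LinearMap.finrank_range_of_inj (f := L.toLinearMap) hL
  have hfq : Module.finrank ℝ F = Module.finrank ℝ q := by
    have := Submodule.finrank_add_eq_of_isCompl hq
    omega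
  let k₀ : F ≃ₗ[ℝ] q := LinearEquiv.ofFinrankEq F q hfq
  let k : F →L[ℝ] E' := LinearMap.toContinuousLinearMap (q.subtype ∘ₗ k₀.toLinearMap)
  have hinj : Function.Injective (L.coprod k).toLinearMap := by
    rw [← LinearMap.ker_eq_bot, LinearMap.ker_eq_bot']
    rintro ⟨v, z⟩ h
    have h' : L v + (k₀ z : E') = 0 := h
    have hmem : L v ∈ L.range ⊓ q := by
      refine ⟨⟨v, rfl⟩, ?_⟩
      rw [eq_neg_of_add_eq_zero_left h']
      exact q.neg_mem (k₀ z).2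
    rw [hq.inf_eq_bot, Submodule.mem_bot] at hmem
    rw [hmem, zero_add, Submodule.coe_eq_zero, LinearEquiv.map_eq_zero_iff] at h'
    exact Prod.ext (hL (hmem.trans (map_zero L).symm)) h'
  have hd : Module.finrank ℝ (E × F) = Module.finrank ℝ E' := by
    rw [Module.finrank_prod, hdim]
  refine ⟨k, (LinearEquiv.ofInjectiveOfFinrankEq _ hinj hd).toContinuousLinearEquiv, ?_⟩
  ext <;> rfl

variable {E : Type*} [NormedAddCommGroup E] [NormedSpace ℝ E] [FiniteDimensional ℝ E]
  {E' : Type} [NormedAddCommGroup E'] [NormedSpace ℝ E'] [FiniteDimensional ℝ E']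
  {H : Type*} [TopologicalSpace H] {I : ModelWithCorners ℝ E H} [I.Boundaryless]
  {H' : Type*} [TopologicalSpace H'] {J : ModelWithCorners ℝ E' H'} [J.Boundaryless]
  {M : Type*} [TopologicalSpace M] [ChartedSpace H M] [IsManifold I ω M]
  {N : Type*} [TopologicalSpace N] [ChartedSpace H' N] [IsManifold J ω N]

/-- An analytic map with injective differential at a point is an immersion there. -/
theorem isImmersionAtOfComplement_of_injective_mfderiv {F : Type*} [NormedAddCommGroup F]
    [NormedSpace ℝ F] [FiniteDimensional ℝ F]
    (hdim : Module.finrank ℝ E + Module.finrank ℝ F = Module.finrank ℝ E')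
    {φ : M → N} (hφ : ContMDiff I J ω φ) (x : M)
    (hinj : Function.Injective (mfderiv I J φ x)) :
    Manifold.IsImmersionAtOfComplement F I J ω φ x := by
  obtain ⟨φ', hφ'⟩ : ∃ φ' : E → E', φ' = writtenInExtChartAt I J x φ := ⟨_, rfl⟩
  set x₀ : E := extChartAt I x x with hx₀
  have hsm : ContDiffAt ℝ ω φ' x₀ := by
    have h := (contMDiffAt_iff.1 (hφ x)).2
    rwa [I.range_eq_univ, contDiffWithinAt_univ, ← writtenInExtChartAt, ← hφ'] at h
  have hder : HasFDerivAt φ' (modelDeriv I J φ x) x₀ :=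
    hφ' ▸ hasFDerivAt_writtenInExtChartAt ((hφ x).mdifferentiableAt (by simp))
  obtain ⟨k, e, he⟩ := exists_equiv_prod_of_injective (F := F)
    (modelDeriv I J φ x) hinj hdim
  -- Thickening `φ'` in the complementary directions gives a map between spaces of equal dimension
  -- whose derivative at `(x₀, 0)` is the equivalence `e`, so the inverse function theorem applies.
  let Ψ : E × F → E' := fun z => φ' z.1 + k z.2
  have hΨ : ContDiffAt ℝ ω Ψ (x₀, 0) := by
    refine ContDiffAt.add ?_ (k.contDiff.comp contDiff_snd).contDiffAt
    exact ContDiffAt.comp (x₀, (0 : F)) hsm contDiffAt_fst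
  have hΨ' : HasFDerivAt Ψ (e : (E × F) →L[ℝ] E') (x₀, 0) := by
    have h1 : HasFDerivAt (fun z : E × F => φ' z.1)
        ((modelDeriv I J φ x).comp (.fst ℝ E F)) (x₀, 0) :=
      HasFDerivAt.comp (x₀, (0 : F)) (f := Prod.fst) hder hasFDerivAt_fst
    have h2 : HasFDerivAt (fun z : E × F => k z.2) (k.comp (.snd ℝ E F)) (x₀, 0) :=
      k.hasFDerivAt.comp (x₀, (0 : F)) hasFDerivAt_snd
    have h3 : (e : (E × F) →L[ℝ] E') =
        (modelDeriv I J φ x).comp (.fst ℝ E F) + k.comp (.snd ℝ E F) := by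
      rw [he]
      ext <;> simp
    rw [h3]
    exact h1.add h2
  let ψ := hΨ.toOpenPartialHomeomorph Ψ hΨ' (by simp)
  -- Analyticity at a point is an open condition, while for `C^∞` at a point the neighbourhoods may
  -- shrink with the order. This is why the argument is run with `ω`.
  let ψ' := ψ.restrContDiff ℝ ω (by simp)
  have hmem : (x₀, (0 : F)) ∈ ψ'.source :=
    ⟨hΨ.mem_toOpenPartialHomeomorph_source hΨ' (by simp), hΨ,
      hΨ.to_localInverse hΨ' (by simp)⟩
  -- The straightened target chart: `ψ'⁻¹` flattens the image to `E × {0}`, and `e` brings `E × F`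
  -- back to the model space.
  let cod : OpenPartialHomeomorph N H' :=
    (chartAt H' (φ x)).trans <| J.toHomeomorph.toOpenPartialHomeomorph.trans <|
      ψ'.symm.trans <| e.toHomeomorph.toOpenPartialHomeomorph.trans
        J.toHomeomorph.symm.toOpenPartialHomeomorph
  have hcod : cod ∈ IsManifold.maximalAtlas J ω N := by
    have hJ : J.Boundaryless := inferInstance
    refine cod.mem_maximalAtlas_of_contMDiffOn ?_ ?_
    · have h1 : ContMDiffOn J J ω (chartAt H' (φ x)) (chartAt H' (φ x)).source :=
        contMDiffOn_chart
      have h2 : ContMDiffOn 𝓘(ℝ, E') 𝓘(ℝ, E × F) ω ψ'.symm ψ'.target :=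
        (ψ.contDiffOn_restrContDiff_target ℝ (by simp)).contMDiffOn
      have h3 : ContMDiff 𝓘(ℝ, E × F) 𝓘(ℝ, E') ω e := e.contDiff.contMDiff
      have h4 : ContMDiff 𝓘(ℝ, E') J ω J.symm := by
        have := J.contMDiffOn_symm (n := ω)
        rwa [J.range_eq_univ, contMDiffOn_univ] at this
      refine (h4.comp h3).comp_contMDiffOn
        (h2.comp (J.contMDiff.comp_contMDiffOn (h1.mono ?_)) ?_)
      · intro y hy
        exact hy.1
      · intro y hy
        have : y ∈ (chartAt H' (φ x)).source ∧ J (chartAt H' (φ x) y) ∈ ψ'.target := by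
          simpa [cod] using hy
        exact this.2
    · have h1 : ContMDiffOn J J ω (chartAt H' (φ x)).symm (chartAt H' (φ x)).target :=
        contMDiffOn_chart_symm
      have h2 : ContMDiffOn 𝓘(ℝ, E × F) 𝓘(ℝ, E') ω ψ' ψ'.source :=
        (ψ.contDiffOn_restrContDiff_source ℝ (by simp)).contMDiffOn
      have h3 : ContMDiff 𝓘(ℝ, E') 𝓘(ℝ, E × F) ω e.symm := e.symm.contDiff.contMDiff
      have h4 : ContMDiff 𝓘(ℝ, E') J ω J.symm := by
        have := J.contMDiffOn_symm (n := ω)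
        rwa [J.range_eq_univ, contMDiffOn_univ] at this
      have key : ∀ y ∈ cod.target, e.symm (J y) ∈ ψ'.source ∧
          J.symm (ψ' (e.symm (J y))) ∈ (chartAt H' (φ x)).target := by
        intro y hy
        simpa [cod] using hy
      refine h1.comp (h4.comp_contMDiffOn (h2.comp (h3.comp J.contMDiff).contMDiffOn ?_)) ?_
      · exact fun y hy => (key y hy).1
      · exact fun y hy => (key y hy).2
  -- The source chart is shrunk to points where the target chart and `ψ'` are both available.
  let s : Set M := {p | φ p ∈ (chartAt H' (φ x)).source ∧ (I (chartAt H x p), (0 : F)) ∈ ψ'.source}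
  have hs : s ∈ nhds x := by
    have h1 : ContinuousAt φ x := (hφ x).continuousAt
    have h2 : ContinuousAt (fun p => (I (chartAt H x p), (0 : F))) x :=
      ((I.continuous.continuousAt).comp
        ((chartAt H x).continuousAt (mem_chart_source H x))).prodMk continuousAt_const
    exact Filter.inter_mem
      (h1.preimage_mem_nhds ((chartAt H' (φ x)).open_source.mem_nhds (mem_chart_source H' (φ x))))
      (h2.preimage_mem_nhds (ψ'.open_source.mem_nhds hmem))
  let dom : OpenPartialHomeomorph M H := (chartAt H x).restr (interior s)
  have hdom : dom ∈ IsManifold.maximalAtlas I ω M :=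
    restr_mem_maximalAtlas _ (IsManifold.chart_mem_maximalAtlas x) isOpen_interior
  have hψ : ∀ p ∈ (chartAt H x).source, J (chartAt H' (φ x) (φ p)) =
      ψ' (I (chartAt H x p), (0 : F)) := by
    intro p hp
    change _ = φ' (I (chartAt H x p)) + k 0
    simp [hφ', writtenInExtChartAt, hp]
  have hsrc : ∀ p ∈ dom.source, p ∈ (chartAt H x).source ∧ p ∈ s := by
    intro p hp
    have hp' : p ∈ (chartAt H x).source ∧ p ∈ interior s := by simpa [dom] using hp
    exact ⟨hp'.1, interior_subset hp'.2⟩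
  refine Manifold.IsImmersionAtOfComplement.mk_of_continuousAt (hφ x).continuousAt e dom cod
    ?_ ?_ hdom hcod ?_
  · simpa [dom] using mem_interior_iff_mem_nhds.2 hs
  · have h1 := hψ x (mem_chart_source H x)
    have h2 := ψ'.map_source hmem
    have : J (chartAt H' (φ x) (φ x)) ∈ ψ'.target := h1 ▸ h2
    simpa [cod] using this
  · intro y hy
    have hy' : I.symm y ∈ dom.target := by
      simpa [OpenPartialHomeomorph.extend, I.range_eq_univ] using hy
    set p := dom.symm (I.symm y) with hp
    have hpm : p ∈ dom.source := dom.map_target hy'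
    have hyp : I (chartAt H x p) = y := by
      have : dom p = I.symm y := dom.right_inv hy'
      have h2 : chartAt H x p = I.symm y := this
      rw [h2]
      exact I.right_inv (I.range_eq_univ ▸ mem_univ y)
    obtain ⟨hp1, -, hp2⟩ := hsrc p hpm
    change J (J.symm (e (ψ'.symm (J (chartAt H' (φ x) (φ p)))))) = e (y, 0)
    rw [hψ p hp1, ψ'.left_inv hp2, hyp]
    exact J.right_inv (J.range_eq_univ ▸ mem_univ _)

/-- An analytic map with injective differential everywhere is a smooth immersion. -/
theorem isImmersion_of_injective_mfderiv
    (hdim : Module.finrank ℝ E ≤ Module.finrank ℝ E')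
    {φ : M → N} (hφ : ContMDiff I J ω φ)
    (hinj : ∀ x, Function.Injective (mfderiv I J φ x)) :
    Manifold.IsImmersion I J ∞ φ := by
  refine ⟨EuclideanSpace ℝ (Fin (Module.finrank ℝ E' - Module.finrank ℝ E)), inferInstance,
    inferInstance, fun x => ?_⟩
  have h := isImmersionAtOfComplement_of_injective_mfderiv
    (F := EuclideanSpace ℝ (Fin (Module.finrank ℝ E' - Module.finrank ℝ E)))
    (by rw [finrank_euclideanSpace_fin]; omega) hφ x (hinj x)
  have hle : (∞ : ℕ∞ω) ≤ ω := le_top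
  exact .mk_of_charts h.equiv h.domChart h.codChart h.mem_domChart_source h.mem_codChart_source
    (StructureGroupoid.maximalAtlas_mono (contDiffGroupoid_le hle) h.domChart_mem_maximalAtlas)
    (StructureGroupoid.maximalAtlas_mono (contDiffGroupoid_le hle) h.codChart_mem_maximalAtlas)
    h.source_subset_preimage_source h.writtenInCharts

end Immersion

/-! ### Christoffel symbols and the Koszul formula. -/

section Christoffel

variable {E : Type*} [NormedAddCommGroup E] [NormedSpace ℝ E]
  {H : Type*} [TopologicalSpace H] {I : ModelWithCorners ℝ E H}
  {M : Type*} [TopologicalSpace M] [ChartedSpace H M]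

/-- The Koszul formula characterizing the Christoffel symbols. -/
theorem SemiRiemannianMetric.val_christoffel [FiniteDimensional ℝ E]
    (g : SemiRiemannianMetric I M) (x₀ : M) (u v w : E) :
    g.val x₀ (g.christoffel x₀ u v) w =
      (1 / 2 : ℝ) * (fderiv ℝ (coordTensor I g.val x₀) (extChartAt I x₀ x₀) u v w +
        fderiv ℝ (coordTensor I g.val x₀) (extChartAt I x₀ x₀) v u w -
        fderiv ℝ (coordTensor I g.val x₀) (extChartAt I x₀ x₀) w u v) := by
  have h := (g.flat x₀).apply_symm_apply ((1 / 2 : ℝ) •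
    (fderiv ℝ (coordTensor I g.val x₀) (extChartAt I x₀ x₀) u v +
      fderiv ℝ (coordTensor I g.val x₀) (extChartAt I x₀ x₀) v u -
      ((fderiv ℝ (coordTensor I g.val x₀) (extChartAt I x₀ x₀)).flip u).flip v))
  exact DFunLike.congr_fun h w

/-- The derivative of the coordinate expression of a metric, from those of its components. -/
theorem SemiRiemannianMetric.fderiv_coordTensor_apply [I.Boundaryless]
    (g : SemiRiemannianMetric I M) (x₀ : M) (u v w : E) :
    fderiv ℝ (coordTensor I g.val x₀) (extChartAt I x₀ x₀) u v w =
      fderiv ℝ (fun y => coordTensor I g.val x₀ y v w) (extChartAt I x₀ x₀) u := by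
  have hd : DifferentiableAt ℝ (coordTensor I g.val x₀) (extChartAt I x₀ x₀) :=
    ((g.smooth x₀).contDiffAt (extChartAt_target_mem_nhds x₀)).differentiableAt (by simp)
  have h1 := (hd.hasFDerivAt.clm_apply (hasFDerivAt_const v _)).clm_apply (hasFDerivAt_const w _)
  rw [h1.fderiv]
  simp

end Christoffel

/-! ### The sphere parametrized by its inverse charts. -/

section SphereParam

variable {V : Type*} [NormedAddCommGroup V] [InnerProductSpace ℝ V] {n : ℕ}
  [Fact (Module.finrank ℝ V = n + 1)]

/-- The parametrization of the unit sphere by the inverse of the preferred chart at `x₀`. -/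
def sphereParam (x₀ : sphere (0 : V) 1) (z : EuclideanSpace ℝ (Fin n)) : V :=
  (extChartAt (𝓡 n) x₀).symm z

theorem contDiffOn_sphereParam (x₀ : sphere (0 : V) 1) :
    ContDiffOn ℝ ∞ (sphereParam (n := n) x₀) (extChartAt (𝓡 n) x₀).target := by
  rw [← contMDiffOn_iff_contDiffOn]
  exact (contMDiff_coe_sphere (m := ∞) (n := n)).comp_contMDiffOn (contMDiffOn_extChartAt_symm x₀)

theorem contDiffAt_sphereParam (x₀ : sphere (0 : V) 1) :
    ContDiffAt ℝ ∞ (sphereParam (n := n) x₀) (extChartAt (𝓡 n) x₀ x₀) :=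
  (contDiffOn_sphereParam x₀).contDiffAt (extChartAt_target_mem_nhds x₀)

theorem norm_sphereParam (x₀ : sphere (0 : V) 1) (z : EuclideanSpace ℝ (Fin n)) :
    ‖sphereParam x₀ z‖ = 1 :=
  norm_eq_of_mem_sphere _

theorem sphereParam_extChartAt_self (x₀ : sphere (0 : V) 1) :
    sphereParam x₀ (extChartAt (𝓡 n) x₀ x₀) = x₀ := by
  rw [sphereParam, extChartAt_to_inv]

theorem hasFDerivAt_sphereParam_self (x₀ : sphere (0 : V) 1) :
    HasFDerivAt (sphereParam x₀) (sphereInclDeriv x₀) (extChartAt (𝓡 n) x₀ x₀) :=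
  hasFDerivAt_writtenInExtChartAt
    ((contMDiff_coe_sphere (m := 1) (n := n)).mdifferentiable one_ne_zero x₀)

/-- The chain rule for the inclusion after the inverse chart: the metric coefficients are the Gram
matrix of `sphereParam`. -/
theorem coordTensor_roundVal (x₀ : sphere (0 : V) 1) {y : EuclideanSpace ℝ (Fin n)}
    (hy : y ∈ (extChartAt (𝓡 n) x₀).target) (v w : EuclideanSpace ℝ (Fin n)) :
    coordTensor (𝓡 n) (roundMetric (V := V) (n := n)).val x₀ y v w =
      ⟪fderiv ℝ (sphereParam x₀) y v, fderiv ℝ (sphereParam x₀) y w⟫_ℝ := by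
  have h1 : MDifferentiableAt 𝓘(ℝ, EuclideanSpace ℝ (Fin n)) (𝓡 n)
      (extChartAt (𝓡 n) x₀).symm y :=
    mdifferentiableAt_symm_of_mem _ hy
  have h2 : MDifferentiableAt (𝓡 n) 𝓘(ℝ, V) (fun q : sphere (0 : V) 1 => (q : V))
      ((extChartAt (𝓡 n) x₀).symm y) :=
    (contMDiff_coe_sphere (m := 1) (n := n)).mdifferentiable one_ne_zero _
  have h3 := mfderiv_comp y h2 h1
  rw [mfderiv_eq_fderiv] at h3
  have hu := DFunLike.congr_fun h3 v
  have hv := DFunLike.congr_fun h3 w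
  exact (congrArg₂ (fun a b : V => ⟪a, b⟫_ℝ) hu hv).symm

end SphereParam

/-! ### Metric coefficients of warped products. -/

section Warped

variable {E : Type*} [NormedAddCommGroup E] [NormedSpace ℝ E]
  {H : Type*} [TopologicalSpace H] {I : ModelWithCorners ℝ E H}
  {M : Type*} [TopologicalSpace M] [ChartedSpace H M]

theorem extChartAt_opens_symm_coe {U : TopologicalSpace.Opens ℝ} (t₀ : U) {y : ℝ}
    (hy : y ∈ (extChartAt 𝓘(ℝ, ℝ) t₀).target) :
    (((extChartAt 𝓘(ℝ, ℝ) t₀).symm y : U) : ℝ) = y :=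
  (extChartAt 𝓘(ℝ, ℝ) t₀).right_inv hy

/-- The chart of an open subset of `ℝ` is the inclusion, so the differential of the inverse product
chart is the identity on the time factor. -/
theorem coordTensor_warpedVal (U : TopologicalSpace.Opens ℝ) (f : ℝ → ℝ)
    [IsManifold I 1 M] [I.Boundaryless] (g : SemiRiemannianMetric I M) (x₀ : U × M) {y : ℝ × E}
    (hy : y ∈ (extChartAt (𝓘(ℝ, ℝ).prod I) x₀).target) (v w : ℝ × E) :
    coordTensor (𝓘(ℝ, ℝ).prod I) (fun q : U × M => warpedVal U f g q) x₀ y v w =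
      f y.1 ^ 2 * coordTensor I g.val x₀.2 y.2 v.2 w.2 - v.1 * w.1 := by
  have hid := fun z hz => extChartAt_opens_symm_coe x₀.1 (y := z) hz
  have hd : ∀ y ∈ (extChartAt 𝓘(ℝ, ℝ) x₀.1).target,
      HasMFDerivAt 𝓘(ℝ, ℝ) 𝓘(ℝ, ℝ) (extChartAt 𝓘(ℝ, ℝ) x₀.1).symm y (.id ℝ ℝ) := by
    intro y hy
    refine ⟨(mdifferentiableAt_symm_of_mem 𝓘(ℝ, ℝ) hy).continuousAt, ?_⟩
    refine ((hasFDerivAt_id (𝕜 := ℝ) y).congr_of_eventuallyEq ?_).hasFDerivWithinAt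
    filter_upwards [(isOpen_extChartAt_target (I := 𝓘(ℝ, ℝ)) x₀.1).mem_nhds hy] with z hz
    exact hid z hz
  rw [extChartAt_prod] at hy
  have h2 := (mdifferentiableAt_symm_of_mem I hy.2).hasMFDerivAt
  have h3 := ((hd y.1 hy.1).prodMap h2).mfderiv
  have h4 : ∀ u : ℝ × E,
      (mfderiv 𝓘(ℝ, ℝ × E) (𝓘(ℝ, ℝ).prod I)
        (extChartAt (𝓘(ℝ, ℝ).prod I) x₀).symm y : (ℝ × E) →L[ℝ] (ℝ × E)) u =
      (u.1, (mfderiv 𝓘(ℝ, E) I (extChartAt I x₀.2).symm y.2 : E →L[ℝ] E) u.2) := by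
    intro u
    rw [(hd y.1 hy.1).mfderiv] at h3
    rw [extChartAt_prod, modelWithCornersSelf_prod, ← chartedSpaceSelf_prod]
    exact DFunLike.congr_fun h3 u
  have h5 : (extChartAt (𝓘(ℝ, ℝ).prod I) x₀).symm y =
      ((extChartAt 𝓘(ℝ, ℝ) x₀.1).symm y.1, (extChartAt I x₀.2).symm y.2) := by
    rw [extChartAt_prod]; rfl
  change warpedVal U f g ((extChartAt (𝓘(ℝ, ℝ).prod I) x₀).symm y)
    ((mfderiv 𝓘(ℝ, ℝ × E) (𝓘(ℝ, ℝ).prod I)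
        (extChartAt (𝓘(ℝ, ℝ).prod I) x₀).symm y : (ℝ × E) →L[ℝ] (ℝ × E)) v)
    ((mfderiv 𝓘(ℝ, ℝ × E) (𝓘(ℝ, ℝ).prod I)
        (extChartAt (𝓘(ℝ, ℝ).prod I) x₀).symm y : (ℝ × E) →L[ℝ] (ℝ × E)) w) = _
  rw [h4, h4, h5]
  change f ((extChartAt 𝓘(ℝ, ℝ) x₀.1).symm y.1 : U) ^ 2 *
    coordTensor I g.val x₀.2 y.2 v.2 w.2 - v.1 * w.1 = _
  rw [hid y.1 hy.1]

end Warped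

/-! ### Levi-Civita connection of the warped product with a sphere. -/

section WarpedSphere

variable {V : Type*} [NormedAddCommGroup V] [InnerProductSpace ℝ V] {n : ℕ}
  [Fact (Module.finrank ℝ V = n + 1)]
  {U : TopologicalSpace.Opens ℝ} {f : ℝ → ℝ} (hf : ContDiffOn ℝ ∞ f U) (hpos : ∀ t ∈ U, 0 < f t)

theorem warpedMetric_round_val (q : U × sphere (0 : V) 1)
    (v w : ℝ × EuclideanSpace ℝ (Fin n)) :
    (warpedMetric U f hf hpos (roundMetric (V := V) (n := n))).val q v w =
      f q.1 ^ 2 * ⟪sphereInclDeriv q.2 v.2, sphereInclDeriv q.2 w.2⟫_ℝ - v.1 * w.1 :=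
  rfl

/-- The product rule applied to `f² ⟪Dσ v, Dσ w⟫ - v₁w₁`, where `σ` is `sphereParam` and the last
term is constant. -/
theorem fderiv_coordTensor_warpedMetric_round (q : U × sphere (0 : V) 1)
    (u v w : ℝ × EuclideanSpace ℝ (Fin n)) :
    fderiv ℝ (coordTensor (𝓘(ℝ, ℝ).prod (𝓡 n))
        (warpedMetric U f hf hpos (roundMetric (V := V) (n := n))).val q)
        (extChartAt (𝓘(ℝ, ℝ).prod (𝓡 n)) q q) u v w =
      2 * f q.1 * deriv f q.1 * u.1 * ⟪sphereInclDeriv q.2 v.2, sphereInclDeriv q.2 w.2⟫_ℝ +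
      f q.1 ^ 2 *
        (⟪fderiv ℝ (fderiv ℝ (sphereParam q.2)) (extChartAt (𝓡 n) q.2 q.2) u.2 v.2,
          sphereInclDeriv q.2 w.2⟫_ℝ +
        ⟪sphereInclDeriv q.2 v.2,
          fderiv ℝ (fderiv ℝ (sphereParam q.2)) (extChartAt (𝓡 n) q.2 q.2) u.2 w.2⟫_ℝ) := by
  rw [SemiRiemannianMetric.fderiv_coordTensor_apply]
  set D := fderiv ℝ (sphereParam (n := n) q.2) with hD
  set ξ := extChartAt (𝓡 n) q.2 q.2 with hξ
  have hq : extChartAt (𝓘(ℝ, ℝ).prod (𝓡 n)) q q = ((q.1 : ℝ), ξ) := by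
    rw [extChartAt_prod]; rfl
  have hDξ : D ξ = sphereInclDeriv q.2 := (hasFDerivAt_sphereParam_self q.2).fderiv
  have hev : (fun y => coordTensor (𝓘(ℝ, ℝ).prod (𝓡 n))
      (warpedMetric U f hf hpos (roundMetric (V := V) (n := n))).val q y v w) =ᶠ[
      nhds (extChartAt (𝓘(ℝ, ℝ).prod (𝓡 n)) q q)]
      fun y => f y.1 ^ 2 * ⟪D y.2 v.2, D y.2 w.2⟫_ℝ - v.1 * w.1 := by
    filter_upwards [extChartAt_target_mem_nhds (I := 𝓘(ℝ, ℝ).prod (𝓡 n)) q] with y hy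
    have h := coordTensor_warpedVal U f (roundMetric (V := V) (n := n)) q hy v w
    rw [extChartAt_prod] at hy
    rw [coordTensor_roundVal q.2 hy.2] at h
    exact h
  rw [hev.fderiv_eq, hq]
  have hf' : HasDerivAt f (deriv f q.1) q.1 :=
    ((hf.contDiffAt (U.isOpen.mem_nhds q.1.2)).differentiableAt (by simp)).hasDerivAt
  have h1 : HasFDerivAt (fun y : ℝ × EuclideanSpace ℝ (Fin n) => f y.1)
      (deriv f q.1 • ContinuousLinearMap.fst ℝ ℝ (EuclideanSpace ℝ (Fin n))) ((q.1 : ℝ), ξ) :=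
    HasDerivAt.comp_hasFDerivAt ((q.1 : ℝ), ξ) hf' hasFDerivAt_fst
  have hD1 : HasFDerivAt D (fderiv ℝ D ξ) ξ := by
    have : ContDiffAt ℝ 1 D ξ := (contDiffAt_sphereParam q.2).fderiv_right
      (one_add_one_eq_two.le.trans ENat.LEInfty.out)
    exact (this.differentiableAt (by simp)).hasFDerivAt
  have hD2 : ∀ z, HasFDerivAt (fun y : ℝ × EuclideanSpace ℝ (Fin n) => D y.2 z)
      ((ContinuousLinearMap.apply ℝ V z).comp ((fderiv ℝ D ξ).comp (.snd ℝ ℝ _)))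
      ((q.1 : ℝ), ξ) := by
    intro z
    have h : HasFDerivAt (fun y : ℝ × EuclideanSpace ℝ (Fin n) => D y.2)
        ((fderiv ℝ D ξ).comp (.snd ℝ ℝ _)) ((q.1 : ℝ), ξ) :=
      HasFDerivAt.comp (g := D) (f := Prod.snd) ((q.1 : ℝ), ξ) hD1 hasFDerivAt_snd
    exact (ContinuousLinearMap.apply ℝ V z).hasFDerivAt.comp ((q.1 : ℝ), ξ) h
  have h2 := ((h1.pow 2).mul ((hD2 v.2).inner ℝ (hD2 w.2))).sub_const (v.1 * w.1)
  have h3 : HasFDerivAt (fun y : ℝ × EuclideanSpace ℝ (Fin n) =>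
      f y.1 ^ 2 * ⟪D y.2 v.2, D y.2 w.2⟫_ℝ - v.1 * w.1) _ ((q.1 : ℝ), ξ) := h2
  rw [h3.fderiv]
  simp [hDξ]
  ring

/-- By symmetry of `D²σ`, four of the six terms `⟪D²σ, Dσ⟫` in the Koszul formula cancel and the
other two coincide. What remains says that the sphere's connection is the tangential part of the
flat one; the `f f'` terms come from differentiating the warping factor. -/
theorem warpedMetric_round_val_christoffel (q : U × sphere (0 : V) 1)
    (u v w : ℝ × EuclideanSpace ℝ (Fin n)) :
    (warpedMetric U f hf hpos (roundMetric (V := V) (n := n))).val q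
        ((warpedMetric U f hf hpos (roundMetric (V := V) (n := n))).christoffel q u v) w =
      f q.1 * deriv f q.1 *
        (u.1 * ⟪sphereInclDeriv q.2 v.2, sphereInclDeriv q.2 w.2⟫_ℝ +
          v.1 * ⟪sphereInclDeriv q.2 u.2, sphereInclDeriv q.2 w.2⟫_ℝ -
          w.1 * ⟪sphereInclDeriv q.2 u.2, sphereInclDeriv q.2 v.2⟫_ℝ) +
      f q.1 ^ 2 *
        ⟪fderiv ℝ (fderiv ℝ (sphereParam q.2)) (extChartAt (𝓡 n) q.2 q.2) u.2 v.2,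
          sphereInclDeriv q.2 w.2⟫_ℝ := by
  rw [SemiRiemannianMetric.val_christoffel]
  simp only [fderiv_coordTensor_warpedMetric_round]
  have hsymm : IsSymmSndFDerivAt ℝ (sphereParam (n := n) q.2) (extChartAt (𝓡 n) q.2 q.2) :=
    (contDiffAt_sphereParam q.2).isSymmSndFDerivAt (by simpa using ENat.LEInfty.out)
  rw [hsymm v.2 u.2, hsymm w.2 u.2, hsymm w.2 v.2]
  have h2 := real_inner_comm (sphereInclDeriv (n := n) q.2 v.2)
    (fderiv ℝ (fderiv ℝ (sphereParam q.2)) (extChartAt (𝓡 n) q.2 q.2) u.2 w.2)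
  rw [h2]
  ring

end WarpedSphere

/-- The second derivative of a composition. -/
theorem fderiv_fderiv_comp {E₁ E₂ E₃ : Type*} [NormedAddCommGroup E₁] [NormedSpace ℝ E₁]
    [NormedAddCommGroup E₂] [NormedSpace ℝ E₂] [NormedAddCommGroup E₃] [NormedSpace ℝ E₃]
    {g : E₂ → E₃} {h : E₁ → E₂} {x : E₁} (hg : ContDiffAt ℝ 2 g (h x)) (hh : ContDiffAt ℝ 2 h x)
    (X Y : E₁) :
    fderiv ℝ (fderiv ℝ (g ∘ h)) x X Y =
      fderiv ℝ (fderiv ℝ g) (h x) (fderiv ℝ h x X) (fderiv ℝ h x Y) +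
        fderiv ℝ g (h x) (fderiv ℝ (fderiv ℝ h) x X Y) := by
  have hev : fderiv ℝ (g ∘ h) =ᶠ[nhds x] fun y => (fderiv ℝ g (h y)).comp (fderiv ℝ h y) := by
    have h1 : ∀ᶠ y in nhds x, DifferentiableAt ℝ h y :=
      (hh.eventually (by simp)).mono fun y hy => hy.differentiableAt (by simp)
    have h2 : ∀ᶠ y in nhds x, DifferentiableAt ℝ g (h y) :=
      hh.continuousAt.eventually
        ((hg.eventually (by simp)).mono fun y hy => hy.differentiableAt (by simp))
    filter_upwards [h1, h2] with y hy1 hy2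
    exact fderiv_comp y hy2 hy1
  have hg' : DifferentiableAt ℝ (fderiv ℝ g) (h x) :=
    (hg.fderiv_right (m := 1) one_add_one_eq_two.le).differentiableAt (by simp)
  have hh' : DifferentiableAt ℝ (fderiv ℝ h) x :=
    (hh.fderiv_right (m := 1) one_add_one_eq_two.le).differentiableAt (by simp)
  have h3 : HasFDerivAt (fun y => fderiv ℝ g (h y))
      ((fderiv ℝ (fderiv ℝ g) (h x)).comp (fderiv ℝ h x)) x :=
    HasFDerivAt.comp x (g := fderiv ℝ g) hg'.hasFDerivAt
      (hh.differentiableAt (by simp)).hasFDerivAt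
  rw [hev.fderiv_eq, (h3.clm_comp hh'.hasFDerivAt).fderiv]
  simp [add_comm]

/-- The scalar product on the tangent space at `x`, on the model space. -/
def SemiRiemannianMetric.modelVal {E : Type*} [NormedAddCommGroup E] [NormedSpace ℝ E]
    {H : Type*} [TopologicalSpace H] {I : ModelWithCorners ℝ E H}
    {M : Type*} [TopologicalSpace M] [ChartedSpace H M]
    (g : SemiRiemannianMetric I M) (x : M) : E →L[ℝ] E →L[ℝ] ℝ := g.val x

/-! ### Maps into a slice, differentiated in the ambient Euclidean space. -/

section SliceMap

variable {V : Type*} [NormedAddCommGroup V] [InnerProductSpace ℝ V] {n : ℕ}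
  [Fact (Module.finrank ℝ V = n + 1)]
  {U : TopologicalSpace.Opens ℝ} {f : ℝ → ℝ} (hf : ContDiffOn ℝ ∞ f U) (hpos : ∀ t ∈ U, 0 < f t)
  {E' : Type*} [NormedAddCommGroup E'] [NormedSpace ℝ E']
  {H' : Type*} [TopologicalSpace H'] {J : ModelWithCorners ℝ E' H'}
  {S : Type*} [TopologicalSpace S] [ChartedSpace H' S]
  {F : S → sphere (0 : V) 1} (t₀ : U) (p : S)

variable (J F) in
/-- The local expression, as a map into `V`, of a map to the unit sphere of `V`. -/
def localExpr (y : E') : V := F ((extChartAt J p).symm y)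

theorem contDiffAt_writtenInExtChartAt [J.Boundaryless] (hF : ContMDiff J (𝓡 n) ∞ F) :
    ContDiffAt ℝ ∞ (writtenInExtChartAt J (𝓡 n) p F) (extChartAt J p p) := by
  have h := (contMDiffAt_iff.1 (hF p)).2
  rwa [J.range_eq_univ, contDiffWithinAt_univ, ← writtenInExtChartAt] at h

theorem writtenInExtChartAt_self :
    writtenInExtChartAt J (𝓡 n) p F (extChartAt J p p) = extChartAt (𝓡 n) (F p) (F p) := by
  simp [writtenInExtChartAt]

theorem localExpr_eventuallyEq (hF : ContMDiff J (𝓡 n) ∞ F) :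
    localExpr J F p =ᶠ[nhds (extChartAt J p p)]
      sphereParam (F p) ∘ writtenInExtChartAt J (𝓡 n) p F := by
  have h1 : ContinuousAt (F ∘ (extChartAt J p).symm) (extChartAt J p p) := by
    refine ContinuousAt.comp ?_ (continuousAt_extChartAt_symm p)
    rw [extChartAt_to_inv]
    exact (hF p).continuousAt
  have h2 : (extChartAt (𝓡 n) (F p)).source ∈
      nhds ((F ∘ (extChartAt J p).symm) (extChartAt J p p)) := by
    rw [Function.comp_apply, extChartAt_to_inv]
    exact extChartAt_source_mem_nhds (F p)
  filter_upwards [h1.preimage_mem_nhds h2] with y hy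
  change _ = ((extChartAt (𝓡 n) (F p)).symm (extChartAt (𝓡 n) (F p)
    (F ((extChartAt J p).symm y))) : V)
  exact congrArg Subtype.val ((extChartAt (𝓡 n) (F p)).left_inv hy).symm

theorem fderiv_localExpr [J.Boundaryless] (hF : ContMDiff J (𝓡 n) ∞ F) (X : E') :
    fderiv ℝ (localExpr J F p) (extChartAt J p p) X =
      sphereInclDeriv (F p) (modelDeriv J (𝓡 n) F p X) := by
  have h1 := hasFDerivAt_writtenInExtChartAt ((hF p).mdifferentiableAt (by simp))
  have h2 := hasFDerivAt_sphereParam_self (n := n) (F p)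
  rw [← writtenInExtChartAt_self (J := J) p] at h2
  rw [(localExpr_eventuallyEq p hF).fderiv_eq, (h2.comp _ h1).fderiv]
  rfl

/-- The two summands are those of the covariant derivative: paired with tangent vectors, the first
is the sphere's Christoffel term, and the second is the coordinate Hessian. Their sum no longer
depends on the chart at `F p`. -/
theorem fderiv_fderiv_localExpr [J.Boundaryless] (hF : ContMDiff J (𝓡 n) ∞ F) (X Y : E') :
    fderiv ℝ (fderiv ℝ (localExpr J F p)) (extChartAt J p p) X Y =
      fderiv ℝ (fderiv ℝ (sphereParam (F p))) (extChartAt (𝓡 n) (F p) (F p))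
        (modelDeriv J (𝓡 n) F p X) (modelDeriv J (𝓡 n) F p Y) +
      sphereInclDeriv (F p) (fderiv ℝ (fderiv ℝ (writtenInExtChartAt J (𝓡 n) p F))
        (extChartAt J p p) X Y) := by
  have h1 := hasFDerivAt_writtenInExtChartAt ((hF p).mdifferentiableAt (by simp))
  have h2 := hasFDerivAt_sphereParam_self (n := n) (F p)
  have h3 := (contDiffAt_sphereParam (n := n) (F p)).of_le (m := 2) ENat.LEInfty.out
  rw [← writtenInExtChartAt_self (J := J) p] at h2 h3
  have h4 := (contDiffAt_writtenInExtChartAt p hF).of_le (m := 2) ENat.LEInfty.out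
  rw [((localExpr_eventuallyEq p hF).fderiv).fderiv_eq, fderiv_fderiv_comp h3 h4, h1.fderiv,
    h2.fderiv, writtenInExtChartAt_self]

theorem writtenInExtChartAt_slice :
    writtenInExtChartAt J (𝓘(ℝ, ℝ).prod (𝓡 n)) p (fun q => (t₀, F q)) =
      (fun z => ((t₀ : ℝ), z)) ∘ writtenInExtChartAt J (𝓡 n) p F := by
  funext y
  rw [writtenInExtChartAt, extChartAt_prod]
  rfl

theorem modelDeriv_slice [J.Boundaryless] (hF : ContMDiff J (𝓡 n) ∞ F) (X : E') :
    modelDeriv J (𝓘(ℝ, ℝ).prod (𝓡 n)) (fun q => (t₀, F q)) p X =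
      ((0 : ℝ), modelDeriv J (𝓡 n) F p X) := by
  have h1 := hasFDerivAt_writtenInExtChartAt ((hF p).mdifferentiableAt (by simp))
  have hφ : ContMDiff J (𝓘(ℝ, ℝ).prod (𝓡 n)) ∞ (fun q => (t₀, F q)) := contMDiff_const.prodMk hF
  have h2 := hasFDerivAt_writtenInExtChartAt ((hφ p).mdifferentiableAt (by simp))
  rw [writtenInExtChartAt_slice] at h2
  have h3 := h2.unique ((hasFDerivAt_prodMk_right (𝕜 := ℝ) (t₀ : ℝ) _).comp _ h1)
  rw [h3]
  rfl

theorem fderiv_fderiv_writtenInExtChartAt_slice [J.Boundaryless]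
    (hF : ContMDiff J (𝓡 n) ∞ F) (X Y : E') :
    fderiv ℝ (fderiv ℝ (writtenInExtChartAt J (𝓘(ℝ, ℝ).prod (𝓡 n)) p (fun q => (t₀, F q))))
      (extChartAt J p p) X Y =
      ((0 : ℝ), fderiv ℝ (fderiv ℝ (writtenInExtChartAt J (𝓡 n) p F)) (extChartAt J p p) X Y) := by
  have h4 := (contDiffAt_writtenInExtChartAt p hF).of_le (m := 2) ENat.LEInfty.out
  have h0 : fderiv ℝ (fun z : EuclideanSpace ℝ (Fin n) => ((t₀ : ℝ), z)) =
      fun _ => .inr ℝ ℝ _ := funext fun z => (hasFDerivAt_prodMk_right _ _).fderiv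
  have h1 : ContDiff ℝ 2 (fun z : EuclideanSpace ℝ (Fin n) => ((t₀ : ℝ), z)) :=
    contDiff_const.prodMk contDiff_id
  rw [writtenInExtChartAt_slice, fderiv_fderiv_comp h1.contDiffAt h4, h0]
  simp

/-- The covariant derivative along a map into a slice of the warped product of an interval and the
unit sphere of `V`, from the derivatives of its expression as a map into `V`. -/
theorem warpedMetric_round_val_covDerivAlong [J.Boundaryless] (hF : ContMDiff J (𝓡 n) ∞ F)
    (X Y : E') (w : ℝ × EuclideanSpace ℝ (Fin n)) :
    (warpedMetric U f hf hpos (roundMetric (V := V) (n := n))).modelVal (t₀, F p)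
        ((warpedMetric U f hf hpos (roundMetric (V := V) (n := n))).covDerivAlong J
          (fun q => (t₀, F q)) p X Y) w =
      f t₀ ^ 2 * ⟪fderiv ℝ (fderiv ℝ (localExpr J F p)) (extChartAt J p p) X Y,
        sphereInclDeriv (F p) w.2⟫_ℝ -
      f t₀ * deriv f t₀ * w.1 * ⟪fderiv ℝ (localExpr J F p) (extChartAt J p p) X,
        fderiv ℝ (localExpr J F p) (extChartAt J p p) Y⟫_ℝ := by
  set g := warpedMetric U f hf hpos (roundMetric (V := V) (n := n)) with hg
  have h1 : g.covDerivAlong J (fun q => (t₀, F q)) p X Y =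
      (((0 : ℝ), fderiv ℝ (fderiv ℝ (writtenInExtChartAt J (𝓡 n) p F)) (extChartAt J p p) X Y) :
        ℝ × EuclideanSpace ℝ (Fin n)) +
      g.christoffel (t₀, F p)
        ((0 : ℝ), modelDeriv J (𝓡 n) F p X) ((0 : ℝ), modelDeriv J (𝓡 n) F p Y) := by
    rw [← fderiv_fderiv_writtenInExtChartAt_slice t₀ p hF X Y, ← modelDeriv_slice t₀ p hF X,
      ← modelDeriv_slice t₀ p hF Y]
    rfl
  have h2 : ∀ a b : ℝ × EuclideanSpace ℝ (Fin n), g.modelVal (t₀, F p) (a + b) w =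
      g.modelVal (t₀, F p) a w + g.modelVal (t₀, F p) b w := fun a b => by simp
  have h3 := warpedMetric_round_val_christoffel hf hpos (t₀, F p)
    ((0 : ℝ), modelDeriv J (𝓡 n) F p X) ((0 : ℝ), modelDeriv J (𝓡 n) F p Y) w
  have h4 := warpedMetric_round_val hf hpos (t₀, F p) ((0 : ℝ),
    fderiv ℝ (fderiv ℝ (writtenInExtChartAt J (𝓡 n) p F)) (extChartAt J p p) X Y) w
  refine (congrArg (fun a => g.modelVal (t₀, F p) a w) h1).trans ((h2 _ _).trans
    ((congrArg₂ (· + ·) h4 h3).trans ?_))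
  rw [fderiv_fderiv_localExpr p hF, fderiv_localExpr p hF, fderiv_localExpr p hF, inner_add_left]
  ring

end SliceMap

/-! ### Tangent vectors and normal curvature of the sphere. -/

section SphereParamInner

variable {V : Type*} [NormedAddCommGroup V] [InnerProductSpace ℝ V] {n : ℕ}
  [Fact (Module.finrank ℝ V = n + 1)]

theorem inner_sphereParam_fderiv (x₀ : sphere (0 : V) 1) {y : EuclideanSpace ℝ (Fin n)}
    (hy : y ∈ (extChartAt (𝓡 n) x₀).target) (v : EuclideanSpace ℝ (Fin n)) :
    ⟪sphereParam x₀ y, fderiv ℝ (sphereParam x₀) y v⟫_ℝ = 0 := by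
  have hd : HasFDerivAt (sphereParam (n := n) x₀) (fderiv ℝ (sphereParam x₀) y) y :=
    (((contDiffOn_sphereParam x₀).contDiffAt
      ((isOpen_extChartAt_target x₀).mem_nhds hy)).differentiableAt (by simp)).hasFDerivAt
  have h1 := hd.inner ℝ hd
  have h2 : (fun z => ⟪sphereParam (n := n) x₀ z, sphereParam x₀ z⟫_ℝ) = fun _ => 1 := by
    funext z
    rw [real_inner_self_eq_norm_sq, norm_sphereParam, one_pow]
  rw [h2] at h1
  have h3 := DFunLike.congr_fun (h1.unique (hasFDerivAt_const _ _)) v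
  have h4 := real_inner_comm (sphereParam x₀ y) (fderiv ℝ (sphereParam x₀) y v)
  simp at h3
  linarith

theorem inner_sphereInclDeriv (x₀ : sphere (0 : V) 1) (v : EuclideanSpace ℝ (Fin n)) :
    ⟪(x₀ : V), sphereInclDeriv x₀ v⟫_ℝ = 0 := by
  have h := inner_sphereParam_fderiv x₀ (mem_extChartAt_target (I := 𝓡 n) x₀) v
  rwa [sphereParam_extChartAt_self, (hasFDerivAt_sphereParam_self x₀).fderiv] at h

theorem hasFDerivAt_fderiv_sphereParam (x₀ : sphere (0 : V) 1) :
    HasFDerivAt (fderiv ℝ (sphereParam (n := n) x₀))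
      (fderiv ℝ (fderiv ℝ (sphereParam x₀)) (extChartAt (𝓡 n) x₀ x₀)) (extChartAt (𝓡 n) x₀ x₀) :=
  (((contDiffAt_sphereParam x₀).fderiv_right (m := 1)
    (one_add_one_eq_two.le.trans ENat.LEInfty.out)).differentiableAt (by simp)).hasFDerivAt

theorem hasFDerivAt_fderiv_sphereParam_apply (x₀ : sphere (0 : V) 1)
    (v : EuclideanSpace ℝ (Fin n)) :
    HasFDerivAt (fun y => fderiv ℝ (sphereParam x₀) y v)
      ((ContinuousLinearMap.apply ℝ V v).comp
        (fderiv ℝ (fderiv ℝ (sphereParam x₀)) (extChartAt (𝓡 n) x₀ x₀)))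
      (extChartAt (𝓡 n) x₀ x₀) :=
  (ContinuousLinearMap.apply ℝ V v).hasFDerivAt.comp _ (hasFDerivAt_fderiv_sphereParam x₀)

/-- The normal curvatures of the unit sphere. -/
theorem inner_fderiv_fderiv_sphereParam (x₀ : sphere (0 : V) 1)
    (u v : EuclideanSpace ℝ (Fin n)) :
    ⟪(x₀ : V), fderiv ℝ (fderiv ℝ (sphereParam x₀)) (extChartAt (𝓡 n) x₀ x₀) u v⟫_ℝ =
      -⟪sphereInclDeriv x₀ u, sphereInclDeriv x₀ v⟫_ℝ := by
  have h1 := (hasFDerivAt_sphereParam_self x₀).inner ℝ (hasFDerivAt_fderiv_sphereParam_apply x₀ v)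
  have h2 : (fun y => ⟪sphereParam x₀ y, fderiv ℝ (sphereParam x₀) y v⟫_ℝ) =ᶠ[
      nhds (extChartAt (𝓡 n) x₀ x₀)] fun _ => 0 := by
    filter_upwards [extChartAt_target_mem_nhds (I := 𝓡 n) x₀] with y hy
    exact inner_sphereParam_fderiv x₀ hy v
  have h3 := DFunLike.congr_fun
    (h1.unique ((hasFDerivAt_const (0 : ℝ) _).congr_of_eventuallyEq h2)) u
  simp only [ContinuousLinearMap.comp_apply, ContinuousLinearMap.prod_apply,
    fderivInnerCLM_apply, ContinuousLinearMap.apply_apply, zero_apply,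
    sphereParam_extChartAt_self, (hasFDerivAt_sphereParam_self x₀).fderiv] at h3
  linarith

theorem exists_sphereInclDeriv_eq (x₀ : sphere (0 : V) 1) {z : V} (hz : ⟪(x₀ : V), z⟫_ℝ = 0) :
    ∃ v : EuclideanSpace ℝ (Fin n), sphereInclDeriv x₀ v = z := by
  have h : z ∈ (mvfderiv (𝓡 n) ((↑) : sphere (0 : V) 1 → V) x₀).range := by
    rw [range_mvfderiv_subtypeVal, Submodule.mem_orthogonal_singleton_iff_inner_right]
    exact hz
  obtain ⟨v, hv⟩ := h
  exact ⟨v, hv⟩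

theorem sphereInclDeriv_injective (x₀ : sphere (0 : V) 1) :
    Function.Injective (sphereInclDeriv (n := n) x₀) :=
  injective_mvfderiv_subtypeVal_sphere x₀

end SphereParamInner

/-! ### Product tori in the three-sphere. -/

section Torus

instance finrank_complex_fact : Fact (Module.finrank ℝ ℂ = 1 + 1) :=
  ⟨Complex.finrank_real_complex⟩

/-- A point of the circle, as a point of the unit sphere of `ℂ`. -/
def Circle.toSphere (u : Circle) : sphere (0 : ℂ) 1 := u

variable (B : CC ≃ₗᵢ[ℝ] CC) (r₁ r₂ : ℝ)

/-- The linear map `(a, b) ↦ B (r₁ a, r₂ b)`. -/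
def torusLinear : ℂ × ℂ →L[ℝ] CC :=
  (B.toContinuousLinearEquiv : CC →L[ℝ] CC).comp
    (((WithLp.prodContinuousLinearEquiv 2 ℝ ℂ ℂ).symm : ℂ × ℂ →L[ℝ] CC).comp
      ((r₁ • ContinuousLinearMap.id ℝ ℂ).prodMap (r₂ • ContinuousLinearMap.id ℝ ℂ)))

theorem torusLinear_apply (a b : ℂ) :
    torusLinear B r₁ r₂ (a, b) = B (WithLp.toLp 2 (r₁ • a, r₂ • b)) :=
  rfl

theorem inner_map_toLp (a b a' b' : ℂ) :
    ⟪B (WithLp.toLp 2 (a, b)), B (WithLp.toLp 2 (a', b'))⟫_ℝ = ⟪a, a'⟫_ℝ + ⟪b, b'⟫_ℝ := by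
  rw [B.inner_map_map, WithLp.prod_inner_apply]

theorem norm_torusLinear (h : r₁ ^ 2 + r₂ ^ 2 = 1) (u v : Circle) :
    ‖torusLinear B r₁ r₂ (u, v)‖ = 1 := by
  have h1 : ‖torusLinear B r₁ r₂ (u, v)‖ ^ 2 = 1 := by
    rw [torusLinear_apply, ← real_inner_self_eq_norm_sq, inner_map_toLp,
      real_inner_self_eq_norm_sq, real_inner_self_eq_norm_sq]
    rw [norm_smul, norm_smul, Circle.norm_coe, Circle.norm_coe]
    simpa using h
  exact (pow_eq_one_iff_of_nonneg (norm_nonneg _) two_ne_zero).1 h1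

/-- The product torus with radii `r₁` and `r₂` in the three-sphere, moved by `B`. -/
def productTorus (h : r₁ ^ 2 + r₂ ^ 2 = 1) (p : Circle × Circle) : S3 :=
  ⟨torusLinear B r₁ r₂ (p.1, p.2), by simpa using norm_torusLinear B r₁ r₂ h p.1 p.2⟩

variable {r₁ r₂} (h : r₁ ^ 2 + r₂ ^ 2 = 1)

theorem contMDiff_productTorus :
    ContMDiff ((𝓡 1).prod (𝓡 1)) (𝓡 3) ω (productTorus B r₁ r₂ h) := by
  have h1 : ContMDiff (𝓡 1) 𝓘(ℝ, ℂ) ω (fun u : Circle => (u : ℂ)) :=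
    contMDiff_coe_sphere (E := ℂ) (n := 1)
  have h2 : ContMDiff ((𝓡 1).prod (𝓡 1)) 𝓘(ℝ, ℂ × ℂ) ω
      (fun p : Circle × Circle => ((p.1 : ℂ), (p.2 : ℂ))) :=
    (h1.comp contMDiff_fst).prodMk_space (h1.comp contMDiff_snd)
  exact ((torusLinear B r₁ r₂).contDiff.contMDiff.comp h2).codRestrict_sphere
    fun p => by simpa using norm_torusLinear B r₁ r₂ h p.1 p.2

theorem productTorus_injective (h₁ : r₁ ≠ 0) (h₂ : r₂ ≠ 0) :
    Function.Injective (productTorus B r₁ r₂ h) := by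
  intro p q hpq
  have h3 : torusLinear B r₁ r₂ (p.1, p.2) = torusLinear B r₁ r₂ (q.1, q.2) :=
    congrArg Subtype.val hpq
  rw [torusLinear_apply, torusLinear_apply, B.injective.eq_iff, WithLp.toLp_injective 2 |>.eq_iff,
    Prod.mk.injEq, smul_right_injective _ h₁ |>.eq_iff, smul_right_injective _ h₂ |>.eq_iff] at h3
  exact Prod.ext (Circle.coe_injective h3.1) (Circle.coe_injective h3.2)

theorem localExpr_productTorus (p : Circle × Circle) :
    localExpr ((𝓡 1).prod (𝓡 1)) (productTorus B r₁ r₂ h) p =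
      fun y => torusLinear B r₁ r₂
        (sphereParam p.1.toSphere y.1, sphereParam p.2.toSphere y.2) := by
  funext y
  rw [localExpr, extChartAt_prod]
  rfl

theorem extChartAt_circle_prod (p : Circle × Circle) :
    extChartAt ((𝓡 1).prod (𝓡 1)) p p =
      (extChartAt (𝓡 1) p.1.toSphere p.1.toSphere, extChartAt (𝓡 1) p.2.toSphere p.2.toSphere) := by
  rw [extChartAt_prod]
  rfl

/-- Needed on a whole neighbourhood, so that the identity can be differentiated once more. -/
theorem fderiv_localExpr_productTorus_eventually (p : Circle × Circle) :
    ∀ᶠ y in nhds (extChartAt ((𝓡 1).prod (𝓡 1)) p p),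
      ∀ X, fderiv ℝ (localExpr ((𝓡 1).prod (𝓡 1)) (productTorus B r₁ r₂ h) p) y X =
        torusLinear B r₁ r₂ (fderiv ℝ (sphereParam p.1.toSphere) y.1 X.1,
          fderiv ℝ (sphereParam p.2.toSphere) y.2 X.2) := by
  have hd : ∀ u : Circle, ∀ y ∈ (extChartAt (𝓡 1) u.toSphere).target,
      HasFDerivAt (sphereParam (n := 1) u.toSphere) (fderiv ℝ (sphereParam u.toSphere) y) y :=
    fun u y hy => (((contDiffOn_sphereParam u.toSphere).contDiffAt
      ((isOpen_extChartAt_target u.toSphere).mem_nhds hy)).differentiableAt (by simp)).hasFDerivAt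
  rw [extChartAt_circle_prod, localExpr_productTorus]
  filter_upwards [prod_mem_nhds (extChartAt_target_mem_nhds (I := 𝓡 1) p.1.toSphere)
    (extChartAt_target_mem_nhds (I := 𝓡 1) p.2.toSphere)] with y hy X
  have h1 := (torusLinear B r₁ r₂).hasFDerivAt.comp y
    ((hd p.1 y.1 hy.1).prodMap y (hd p.2 y.2 hy.2))
  exact DFunLike.congr_fun h1.fderiv X

theorem fderiv_localExpr_productTorus (p : Circle × Circle)
    (X : EuclideanSpace ℝ (Fin 1) × EuclideanSpace ℝ (Fin 1)) :
    fderiv ℝ (localExpr ((𝓡 1).prod (𝓡 1)) (productTorus B r₁ r₂ h) p)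
        (extChartAt ((𝓡 1).prod (𝓡 1)) p p) X =
      torusLinear B r₁ r₂ (sphereInclDeriv p.1.toSphere X.1, sphereInclDeriv p.2.toSphere X.2) := by
  rw [(fderiv_localExpr_productTorus_eventually B h p).self_of_nhds X, extChartAt_circle_prod,
    (hasFDerivAt_sphereParam_self p.1.toSphere).fderiv,
    (hasFDerivAt_sphereParam_self p.2.toSphere).fderiv]

theorem fderiv_fderiv_localExpr_productTorus (p : Circle × Circle)
    (X Y : EuclideanSpace ℝ (Fin 1) × EuclideanSpace ℝ (Fin 1)) :
    fderiv ℝ (fderiv ℝ (localExpr ((𝓡 1).prod (𝓡 1)) (productTorus B r₁ r₂ h) p))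
        (extChartAt ((𝓡 1).prod (𝓡 1)) p p) X Y =
      torusLinear B r₁ r₂
        (fderiv ℝ (fderiv ℝ (sphereParam p.1.toSphere))
          (extChartAt (𝓡 1) p.1.toSphere p.1.toSphere) X.1 Y.1,
        fderiv ℝ (fderiv ℝ (sphereParam p.2.toSphere))
          (extChartAt (𝓡 1) p.2.toSphere p.2.toSphere) X.2 Y.2) := by
  set K := localExpr ((𝓡 1).prod (𝓡 1)) (productTorus B r₁ r₂ h) p with hK
  set y₀ := extChartAt ((𝓡 1).prod (𝓡 1)) p p with hy₀
  have hsm : ContDiffAt ℝ 2 K y₀ := by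
    rw [hK, hy₀, localExpr_productTorus, extChartAt_circle_prod]
    have h1 := ((contDiffAt_sphereParam (n := 1) p.1.toSphere).prodMap
      (contDiffAt_sphereParam (n := 1) p.2.toSphere)).of_le (m := 2) ENat.LEInfty.out
    exact (torusLinear B r₁ r₂).contDiff.contDiffAt.comp _ h1
  have hd : DifferentiableAt ℝ (fderiv ℝ K) y₀ :=
    (hsm.fderiv_right (m := 1) one_add_one_eq_two.le).differentiableAt (by simp)
  have h1 : HasFDerivAt (fun y => fderiv ℝ K y Y)
      ((ContinuousLinearMap.apply ℝ CC Y).comp (fderiv ℝ (fderiv ℝ K) y₀)) y₀ :=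
    (ContinuousLinearMap.apply ℝ CC Y).hasFDerivAt.comp _ hd.hasFDerivAt
  have h2 := (torusLinear B r₁ r₂).hasFDerivAt.comp
    (extChartAt (𝓡 1) p.1.toSphere p.1.toSphere, extChartAt (𝓡 1) p.2.toSphere p.2.toSphere)
    ((hasFDerivAt_fderiv_sphereParam_apply p.1.toSphere Y.1).prodMap
      (extChartAt (𝓡 1) p.1.toSphere p.1.toSphere, extChartAt (𝓡 1) p.2.toSphere p.2.toSphere)
      (hasFDerivAt_fderiv_sphereParam_apply p.2.toSphere Y.2))
  rw [← extChartAt_circle_prod p] at h2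
  have h3 := h1.congr_of_eventuallyEq ((fderiv_localExpr_productTorus_eventually B h p).mono
    fun y hy => (hy Y).symm)
  exact DFunLike.congr_fun (h3.unique h2) X

end Torus

/-! ### The mean curvature vector through its scalar products. -/

section MeanCurvature

variable {E : Type*} [NormedAddCommGroup E] [NormedSpace ℝ E] [FiniteDimensional ℝ E]
  {H : Type*} [TopologicalSpace H] {I : ModelWithCorners ℝ E H}
  {M : Type*} [TopologicalSpace M] [ChartedSpace H M]
  {E' : Type*} [NormedAddCommGroup E'] [NormedSpace ℝ E']
  {H' : Type*} [TopologicalSpace H'] (J : ModelWithCorners ℝ E' H')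
  {S : Type*} [TopologicalSpace S] [ChartedSpace H' S]

/-- The covariant derivative along a map, with values in the model space. -/
def SemiRiemannianMetric.modelCovDeriv (g : SemiRiemannianMetric I M) (φ : S → M) (p : S)
    (X Y : E') : E :=
  g.covDerivAlong J φ p X Y

/-- Half the trace of the second fundamental form in the frame `e`, in the model space. -/
def SemiRiemannianMetric.meanCurvature (g : SemiRiemannianMetric I M) (φ : S → M) (p : S)
    (e : Module.Basis (Fin 2) ℝ E') : E :=
  (1 / 2 : ℝ) • ∑ i, (g.modelCovDeriv J φ p (e i) (e i) -
    ∑ j, g.modelVal (φ p) (g.modelCovDeriv J φ p (e i) (e i)) (modelDeriv J I φ p (e j)) •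
      modelDeriv J I φ p (e j))

theorem SemiRiemannianMetric.isMeanCurvatureVector_meanCurvature (g : SemiRiemannianMetric I M)
    (φ : S → M) (p : S) (e : Module.Basis (Fin 2) ℝ E')
    (he : ∀ i j, g.modelVal (φ p) (modelDeriv J I φ p (e i)) (modelDeriv J I φ p (e j)) =
      if i = j then 1 else 0) {Hv : E} (hHv : Hv = g.meanCurvature J φ p e) :
    g.IsMeanCurvatureVector J φ p Hv :=
  ⟨e, he, hHv⟩

theorem SemiRiemannianMetric.modelVal_meanCurvature (g : SemiRiemannianMetric I M)
    (φ : S → M) (p : S) (e : Module.Basis (Fin 2) ℝ E') (w : E) :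
    g.modelVal (φ p) (g.meanCurvature J φ p e) w = (1 / 2 : ℝ) * ∑ i,
      (g.modelVal (φ p) (g.modelCovDeriv J φ p (e i) (e i)) w -
        ∑ j, g.modelVal (φ p) (g.modelCovDeriv J φ p (e i) (e i)) (modelDeriv J I φ p (e j)) *
          g.modelVal (φ p) (modelDeriv J I φ p (e j)) w) := by
  have h : ∀ a b c : E, g.modelVal (φ p) (a - b) c =
      g.modelVal (φ p) a c - g.modelVal (φ p) b c := fun a b c => by simp
  rw [meanCurvature, map_smul, map_sum]
  simp only [smul_apply, sum_apply, smul_eq_mul, h,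
    map_sum, map_smul]

end MeanCurvature

/-- Parseval in the orthonormal basis `u, iu` of `ℂ`. It separates the second derivative of a circle
parametrization into its normal part, which is geometric, and its tangential part, which depends on
the chart. -/
theorem Circle.inner_eq (u : Circle) (z w : ℂ) :
    ⟪z, w⟫_ℝ = ⟪(u : ℂ), z⟫_ℝ * ⟪(u : ℂ), w⟫_ℝ +
      ⟪Complex.I * u, z⟫_ℝ * ⟪Complex.I * u, w⟫_ℝ := by
  have hu : (u : ℂ).re ^ 2 + (u : ℂ).im ^ 2 = 1 := by
    have := Circle.normSq_coe u
    rw [Complex.normSq_apply] at this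
    linarith
  simp only [Complex.inner, Complex.mul_re, Complex.mul_im, Complex.conj_re, Complex.conj_im,
    Complex.I_re, Complex.I_im]
  linear_combination (-(z.re * w.re + z.im * w.im)) * hu

theorem Circle.inner_I_mul_self (u : Circle) : ⟪(u : ℂ), Complex.I * u⟫_ℝ = 0 := by
  simp [Complex.inner]
  ring

theorem Circle.norm_I_mul (u : Circle) : ‖Complex.I * (u : ℂ)‖ = 1 := by
  rw [norm_mul, Complex.norm_I, Circle.norm_coe, one_mul]

/-! ### The product torus in a slice: embedding, induced metric, covariant derivative. -/

section TorusMeanCurvature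

variable (B : CC ≃ₗᵢ[ℝ] CC) {r₁ r₂ : ℝ} (h : r₁ ^ 2 + r₂ ^ 2 = 1)
  {U : TopologicalSpace.Opens ℝ} {f : ℝ → ℝ} (hf : ContDiffOn ℝ ∞ f U) (hpos : ∀ t ∈ U, 0 < f t)
  (t₀ : U)

variable (r₁ r₂) in
/-- The product torus in the slice at level `t₀`. -/
def sliceTorus (h : r₁ ^ 2 + r₂ ^ 2 = 1) (p : Circle × Circle) : U × S3 :=
  (t₀, productTorus B r₁ r₂ h p)

theorem contMDiff_sliceTorus :
    ContMDiff ((𝓡 1).prod (𝓡 1)) (𝓘(ℝ, ℝ).prod (𝓡 3)) ω (sliceTorus B r₁ r₂ t₀ h) :=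
  contMDiff_const.prodMk (contMDiff_productTorus B h)

theorem sphereInclDeriv_modelDeriv_productTorus (p : Circle × Circle)
    (X : EuclideanSpace ℝ (Fin 1) × EuclideanSpace ℝ (Fin 1)) :
    sphereInclDeriv (productTorus B r₁ r₂ h p)
        (modelDeriv ((𝓡 1).prod (𝓡 1)) (𝓡 3) (productTorus B r₁ r₂ h) p X) =
      torusLinear B r₁ r₂ (sphereInclDeriv p.1.toSphere X.1, sphereInclDeriv p.2.toSphere X.2) := by
  rw [← fderiv_localExpr_productTorus B h p X,
    fderiv_localExpr p ((contMDiff_productTorus B h).of_le le_top)]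

theorem modelDeriv_sliceTorus (p : Circle × Circle)
    (X : EuclideanSpace ℝ (Fin 1) × EuclideanSpace ℝ (Fin 1)) :
    modelDeriv ((𝓡 1).prod (𝓡 1)) (𝓘(ℝ, ℝ).prod (𝓡 3)) (sliceTorus B r₁ r₂ t₀ h) p X =
      ((0 : ℝ), modelDeriv ((𝓡 1).prod (𝓡 1)) (𝓡 3) (productTorus B r₁ r₂ h) p X) :=
  modelDeriv_slice t₀ p ((contMDiff_productTorus B h).of_le le_top) X

theorem modelVal_flrwMetric (q : U × S3) (v w : ℝ × EuclideanSpace ℝ (Fin 3)) :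
    (flrwMetric U f hf hpos).modelVal q v w =
      f q.1 ^ 2 * ⟪sphereInclDeriv q.2 v.2, sphereInclDeriv q.2 w.2⟫_ℝ - v.1 * w.1 :=
  rfl

theorem modelVal_modelDeriv_sliceTorus (p : Circle × Circle)
    (X : EuclideanSpace ℝ (Fin 1) × EuclideanSpace ℝ (Fin 1))
    (w : ℝ × EuclideanSpace ℝ (Fin 3)) :
    (flrwMetric U f hf hpos).modelVal (sliceTorus B r₁ r₂ t₀ h p)
        (modelDeriv ((𝓡 1).prod (𝓡 1)) (𝓘(ℝ, ℝ).prod (𝓡 3)) (sliceTorus B r₁ r₂ t₀ h) p X) w =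
      f t₀ ^ 2 * ⟪torusLinear B r₁ r₂
          (sphereInclDeriv p.1.toSphere X.1, sphereInclDeriv p.2.toSphere X.2),
        sphereInclDeriv (productTorus B r₁ r₂ h p) w.2⟫_ℝ := by
  rw [modelDeriv_sliceTorus, modelVal_flrwMetric, ← sphereInclDeriv_modelDeriv_productTorus B h]
  simp [sliceTorus]

theorem modelVal_modelDeriv_modelDeriv_sliceTorus (p : Circle × Circle)
    (X Y : EuclideanSpace ℝ (Fin 1) × EuclideanSpace ℝ (Fin 1)) :
    (flrwMetric U f hf hpos).modelVal (sliceTorus B r₁ r₂ t₀ h p)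
        (modelDeriv ((𝓡 1).prod (𝓡 1)) (𝓘(ℝ, ℝ).prod (𝓡 3)) (sliceTorus B r₁ r₂ t₀ h) p X)
        (modelDeriv ((𝓡 1).prod (𝓡 1)) (𝓘(ℝ, ℝ).prod (𝓡 3)) (sliceTorus B r₁ r₂ t₀ h) p Y) =
      f t₀ ^ 2 * (r₁ ^ 2 * ⟪sphereInclDeriv p.1.toSphere X.1, sphereInclDeriv p.1.toSphere Y.1⟫_ℝ +
        r₂ ^ 2 * ⟪sphereInclDeriv p.2.toSphere X.2, sphereInclDeriv p.2.toSphere Y.2⟫_ℝ) := by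
  rw [modelVal_modelDeriv_sliceTorus, modelDeriv_sliceTorus,
    sphereInclDeriv_modelDeriv_productTorus, torusLinear_apply, torusLinear_apply, inner_map_toLp]
  simp only [real_inner_smul_left, real_inner_smul_right]
  ring

theorem isSpacelike_sliceTorus (h₁ : r₁ ≠ 0) (h₂ : r₂ ≠ 0) :
    (flrwMetric U f hf hpos).IsSpacelike ((𝓡 1).prod (𝓡 1)) (sliceTorus B r₁ r₂ t₀ h) := by
  intro p X hX
  have key := modelVal_modelDeriv_modelDeriv_sliceTorus B h hf hpos t₀ p X X
  refine lt_of_lt_of_eq ?_ key.symm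
  have hft := hpos t₀ t₀.2
  rw [real_inner_self_eq_norm_sq, real_inner_self_eq_norm_sq]
  have hinj : ∀ (u : Circle) (x : EuclideanSpace ℝ (Fin 1)), x ≠ 0 →
      0 < ‖sphereInclDeriv u.toSphere x‖ := fun u x hx =>
    norm_pos_iff.2 fun h0 => hx (sphereInclDeriv_injective u.toSphere (h0.trans (map_zero _).symm))
  by_cases hx : X.1 = 0
  · have hy : X.2 ≠ 0 := fun hy => hX (Prod.ext hx hy)
    have := hinj p.2 X.2 hy
    positivity
  · have := hinj p.1 X.1 hx
    positivity

/-- A spacelike map kills no nonzero tangent vector. The differential does not involve the metric,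
so the warping function `1` suffices. -/
theorem injective_mfderiv_sliceTorus (h₁ : r₁ ≠ 0) (h₂ : r₂ ≠ 0) (p : Circle × Circle) :
    Function.Injective (mfderiv ((𝓡 1).prod (𝓡 1)) (𝓘(ℝ, ℝ).prod (𝓡 3))
      (sliceTorus B r₁ r₂ t₀ h) p) := by
  have hone : ∀ t ∈ U, (0 : ℝ) < (fun _ => 1) t := fun _ _ => one_pos
  refine (injective_iff_map_eq_zero _).2 fun X hX => by_contra fun hne => ?_
  have := isSpacelike_sliceTorus B h contDiffOn_const hone t₀ h₁ h₂ p X hne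
  rw [hX, map_zero] at this
  exact lt_irrefl _ this

theorem isSmoothEmbedding_sliceTorus (h₁ : r₁ ≠ 0) (h₂ : r₂ ≠ 0) :
    Manifold.IsSmoothEmbedding ((𝓡 1).prod (𝓡 1)) (𝓘(ℝ, ℝ).prod (𝓡 3)) ∞
      (sliceTorus B r₁ r₂ t₀ h) := by
  refine ⟨isImmersion_of_injective_mfderiv (by simp) (contMDiff_sliceTorus B h t₀)
    (injective_mfderiv_sliceTorus B h t₀ h₁ h₂), ?_⟩
  -- A continuous injection of a compact space into a Hausdorff space is a closed embedding.
  refine ((contMDiff_sliceTorus B h t₀).continuous.isClosedEmbedding ?_).isEmbedding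
  intro p q hpq
  exact productTorus_injective B h h₁ h₂ (congrArg Prod.snd hpq)

/-- Tangent vectors of the three-sphere at a point of the product torus, in coordinates. -/
theorem exists_sphereInclDeriv_productTorus_eq (p : Circle × Circle)
    (w : EuclideanSpace ℝ (Fin 3)) :
    ∃ a b : ℂ, sphereInclDeriv (productTorus B r₁ r₂ h p) w = B (WithLp.toLp 2 (a, b)) ∧
      r₁ * ⟪(p.1 : ℂ), a⟫_ℝ + r₂ * ⟪(p.2 : ℂ), b⟫_ℝ = 0 := by
  set z := B.symm (sphereInclDeriv (productTorus B r₁ r₂ h p) w) with hz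
  have h1 : sphereInclDeriv (productTorus B r₁ r₂ h p) w = B (WithLp.toLp 2 (z.fst, z.snd)) := by
    change _ = B z
    rw [hz, B.apply_symm_apply]
  refine ⟨z.fst, z.snd, h1, ?_⟩
  have h2 := inner_sphereInclDeriv (productTorus B r₁ r₂ h p) w
  rw [h1] at h2
  have h3 : ⟪torusLinear B r₁ r₂ (p.1, p.2), B (WithLp.toLp 2 (z.fst, z.snd))⟫_ℝ = 0 := h2
  rw [torusLinear_apply, inner_map_toLp, real_inner_smul_left, real_inner_smul_left] at h3
  exact h3

theorem modelVal_covDerivAlong_sliceTorus (p : Circle × Circle)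
    (X : EuclideanSpace ℝ (Fin 1) × EuclideanSpace ℝ (Fin 1))
    (w : ℝ × EuclideanSpace ℝ (Fin 3)) :
    (flrwMetric U f hf hpos).modelVal (sliceTorus B r₁ r₂ t₀ h p)
        ((flrwMetric U f hf hpos).modelCovDeriv ((𝓡 1).prod (𝓡 1))
          (sliceTorus B r₁ r₂ t₀ h) p X X) w =
      f t₀ ^ 2 * ⟪torusLinear B r₁ r₂
          (fderiv ℝ (fderiv ℝ (sphereParam p.1.toSphere))
            (extChartAt (𝓡 1) p.1.toSphere p.1.toSphere) X.1 X.1,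
          fderiv ℝ (fderiv ℝ (sphereParam p.2.toSphere))
            (extChartAt (𝓡 1) p.2.toSphere p.2.toSphere) X.2 X.2),
        sphereInclDeriv (productTorus B r₁ r₂ h p) w.2⟫_ℝ -
      f t₀ * deriv f t₀ * w.1 *
        (r₁ ^ 2 * ‖sphereInclDeriv p.1.toSphere X.1‖ ^ 2 +
          r₂ ^ 2 * ‖sphereInclDeriv p.2.toSphere X.2‖ ^ 2) := by
  refine (warpedMetric_round_val_covDerivAlong hf hpos t₀ p
    ((contMDiff_productTorus B h).of_le le_top) X X w).trans ?_
  rw [fderiv_fderiv_localExpr_productTorus, fderiv_localExpr_productTorus, torusLinear_apply,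
    torusLinear_apply, inner_map_toLp]
  simp only [real_inner_self_eq_norm_sq, norm_smul, mul_pow, Real.norm_eq_abs, sq_abs]

end TorusMeanCurvature

/-! ### Mean curvature vector of the product torus. -/

section TorusFrame

variable (B : CC ≃ₗᵢ[ℝ] CC) {r₁ r₂ : ℝ} (h : r₁ ^ 2 + r₂ ^ 2 = 1)
  {U : TopologicalSpace.Opens ℝ} {f : ℝ → ℝ} (hf : ContDiffOn ℝ ∞ f U) (hpos : ∀ t ∈ U, 0 < f t)
  (t₀ : U)

/-- The basis `(x, 0), (0, y)` of the product of two lines. -/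
theorem exists_basis_prod {x y : EuclideanSpace ℝ (Fin 1)} (hx : x ≠ 0) (hy : y ≠ 0) :
    ∃ e : Module.Basis (Fin 2) ℝ (EuclideanSpace ℝ (Fin 1) × EuclideanSpace ℝ (Fin 1)),
      e 0 = (x, 0) ∧ e 1 = (0, y) := by
  have hli : LinearIndependent ℝ
      ![((x, 0) : EuclideanSpace ℝ (Fin 1) × EuclideanSpace ℝ (Fin 1)), (0, y)] := by
    rw [LinearIndependent.pair_iff]
    intro s t hst
    have h1 := congrArg Prod.fst hst
    have h2 := congrArg Prod.snd hst
    simp only [Prod.fst_add, Prod.snd_add, Prod.smul_fst, Prod.smul_snd, smul_zero, add_zero,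
      zero_add, Prod.fst_zero, Prod.snd_zero, smul_eq_zero, hx, hy, or_false] at h1 h2
    exact ⟨h1, h2⟩
  refine ⟨basisOfLinearIndependentOfCardEqFinrank hli (by simp), ?_, ?_⟩ <;> simp

/-- The mean curvature vector of the product torus in a slice. -/
theorem exists_isMeanCurvatureVector_sliceTorus (h₁ : 0 < r₁) (h₂ : 0 < r₂)
    (p : Circle × Circle) :
    ∃ Hv : ℝ × EuclideanSpace ℝ (Fin 3),
      (flrwMetric U f hf hpos).IsMeanCurvatureVector ((𝓡 1).prod (𝓡 1))
        (sliceTorus B r₁ r₂ t₀ h) p Hv ∧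
      (flrwMetric U f hf hpos).modelVal (sliceTorus B r₁ r₂ t₀ h p) Hv Hv =
        (((r₁ ^ 2 - r₂ ^ 2) / (r₁ * r₂) / 2) ^ 2 - deriv f t₀ ^ 2) / f t₀ ^ 2 ∧
      (flrwMetric U f hf hpos).modelVal (sliceTorus B r₁ r₂ t₀ h p) Hv (1, 0) =
        -(deriv f t₀ / f t₀) := by
  set g := flrwMetric U f hf hpos with hg
  set φ := sliceTorus B r₁ r₂ t₀ h with hφ
  have hft : 0 < f t₀ := hpos t₀ t₀.2
  -- The factor `(f r₁)⁻¹` makes the image of `(x, 0)` a unit vector, since the first circle has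
  -- length scale `f r₁` in the slice; `y` is chosen likewise.
  obtain ⟨x, hx⟩ := exists_sphereInclDeriv_eq (n := 1) p.1.toSphere
    (z := (f t₀ * r₁)⁻¹ • (Complex.I * (p.1 : ℂ)))
    ((real_inner_smul_right _ _ _).trans (by erw [Circle.inner_I_mul_self p.1]; simp))
  obtain ⟨y, hy⟩ := exists_sphereInclDeriv_eq (n := 1) p.2.toSphere
    (z := (f t₀ * r₂)⁻¹ • (Complex.I * (p.2 : ℂ)))
    ((real_inner_smul_right _ _ _).trans (by erw [Circle.inner_I_mul_self p.2]; simp))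
  have hxn : ‖sphereInclDeriv p.1.toSphere x‖ = (f t₀ * r₁)⁻¹ := by
    rw [hx, norm_smul, Circle.norm_I_mul, mul_one, Real.norm_of_nonneg (by positivity)]
  have hyn : ‖sphereInclDeriv p.2.toSphere y‖ = (f t₀ * r₂)⁻¹ := by
    rw [hy, norm_smul, Circle.norm_I_mul, mul_one, Real.norm_of_nonneg (by positivity)]
  have hx0 : x ≠ 0 := by
    rintro rfl
    rw [map_zero, norm_zero] at hxn
    exact (inv_pos.2 (mul_pos hft h₁)).ne hxn
  have hy0 : y ≠ 0 := by
    rintro rfl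
    rw [map_zero, norm_zero] at hyn
    exact (inv_pos.2 (mul_pos hft h₂)).ne hyn
  obtain ⟨e, he0, he1⟩ := exists_basis_prod hx0 hy0
  -- Only the radial components of `d₁` and `d₂` will be computed: the tangential ones are removed
  -- by the projection onto the normal space.
  obtain ⟨d₁, hd₁⟩ : ∃ d, d = fderiv ℝ (fderiv ℝ (sphereParam p.1.toSphere))
    (extChartAt (𝓡 1) p.1.toSphere p.1.toSphere) x x := ⟨_, rfl⟩
  obtain ⟨d₂, hd₂⟩ : ∃ d, d = fderiv ℝ (fderiv ℝ (sphereParam p.2.toSphere))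
    (extChartAt (𝓡 1) p.2.toSphere p.2.toSphere) y y := ⟨_, rfl⟩
  have hd₁' : ⟪(p.1 : ℂ), d₁⟫_ℝ = -(f t₀ * r₁)⁻¹ ^ 2 := by
    have := inner_fderiv_fderiv_sphereParam p.1.toSphere x x
    rw [real_inner_self_eq_norm_sq, hxn, ← hd₁] at this
    exact this
  have hd₂' : ⟪(p.2 : ℂ), d₂⟫_ℝ = -(f t₀ * r₂)⁻¹ ^ 2 := by
    have := inner_fderiv_fderiv_sphereParam p.2.toSphere y y
    rw [real_inner_self_eq_norm_sq, hyn, ← hd₂] at this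
    exact this
  have horth : ∀ i j, g.modelVal (φ p)
      (modelDeriv ((𝓡 1).prod (𝓡 1)) (𝓘(ℝ, ℝ).prod (𝓡 3)) φ p (e i))
      (modelDeriv ((𝓡 1).prod (𝓡 1)) (𝓘(ℝ, ℝ).prod (𝓡 3)) φ p (e j)) =
      if i = j then 1 else 0 := by
    intro i j
    rw [modelVal_modelDeriv_modelDeriv_sliceTorus]
    fin_cases i <;> fin_cases j <;>
      simp [he0, he1, hxn, hyn] <;> field_simp
  -- Frame vectors and their covariant derivatives are paired with a test vector whose spatial part
  -- is `B (a, b)`. Below, `hw0` and `hw1` give the frame vectors themselves in this form, for use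
  -- in the tangential projection.
  have hD0 : ∀ w a b, sphereInclDeriv (productTorus B r₁ r₂ h p) w.2 = B (WithLp.toLp 2 (a, b)) →
      g.modelVal (φ p) (modelDeriv ((𝓡 1).prod (𝓡 1)) (𝓘(ℝ, ℝ).prod (𝓡 3)) φ p (e 0)) w =
        f t₀ * ⟪Complex.I * p.1, a⟫_ℝ := by
    intro w a b hw
    rw [modelVal_modelDeriv_sliceTorus, he0, hx, hw, torusLinear_apply, inner_map_toLp]
    simp only [real_inner_smul_left, map_zero, inner_zero_left, mul_zero, add_zero]
    field_simp
  have hD1 : ∀ w a b, sphereInclDeriv (productTorus B r₁ r₂ h p) w.2 = B (WithLp.toLp 2 (a, b)) →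
      g.modelVal (φ p) (modelDeriv ((𝓡 1).prod (𝓡 1)) (𝓘(ℝ, ℝ).prod (𝓡 3)) φ p (e 1)) w =
        f t₀ * ⟪Complex.I * p.2, b⟫_ℝ := by
    intro w a b hw
    rw [modelVal_modelDeriv_sliceTorus, he1, hy, hw, torusLinear_apply, inner_map_toLp]
    simp only [real_inner_smul_left, map_zero, inner_zero_left, mul_zero, zero_add]
    field_simp
  have hC0 : ∀ w a b, sphereInclDeriv (productTorus B r₁ r₂ h p) w.2 = B (WithLp.toLp 2 (a, b)) →
      g.modelVal (φ p) (g.modelCovDeriv ((𝓡 1).prod (𝓡 1)) φ p (e 0) (e 0)) w =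
        f t₀ ^ 2 * (r₁ * ⟪d₁, a⟫_ℝ) - deriv f t₀ / f t₀ * w.1 := by
    intro w a b hw
    rw [modelVal_covDerivAlong_sliceTorus, he0, hxn, ← hd₁, hw, torusLinear_apply, inner_map_toLp]
    simp only [real_inner_smul_left, map_zero, inner_zero_left, mul_zero, add_zero, norm_zero]
    field_simp
    ring
  have hC1 : ∀ w a b, sphereInclDeriv (productTorus B r₁ r₂ h p) w.2 = B (WithLp.toLp 2 (a, b)) →
      g.modelVal (φ p) (g.modelCovDeriv ((𝓡 1).prod (𝓡 1)) φ p (e 1) (e 1)) w =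
        f t₀ ^ 2 * (r₂ * ⟪d₂, b⟫_ℝ) - deriv f t₀ / f t₀ * w.1 := by
    intro w a b hw
    rw [modelVal_covDerivAlong_sliceTorus, he1, hyn, ← hd₂, hw, torusLinear_apply, inner_map_toLp]
    simp only [real_inner_smul_left, map_zero, inner_zero_left, mul_zero, zero_add, norm_zero]
    field_simp
    ring
  have hw0 : sphereInclDeriv (productTorus B r₁ r₂ h p)
      (modelDeriv ((𝓡 1).prod (𝓡 1)) (𝓘(ℝ, ℝ).prod (𝓡 3)) φ p (e 0)).2 =
      B (WithLp.toLp 2 ((f t₀)⁻¹ • (Complex.I * p.1), 0)) := by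
    rw [modelDeriv_sliceTorus, sphereInclDeriv_modelDeriv_productTorus, he0, hx, map_zero,
      torusLinear_apply, smul_zero, smul_smul, mul_inv_rev, mul_inv_cancel_left₀ h₁.ne']
  have hw1 : sphereInclDeriv (productTorus B r₁ r₂ h p)
      (modelDeriv ((𝓡 1).prod (𝓡 1)) (𝓘(ℝ, ℝ).prod (𝓡 3)) φ p (e 1)).2 =
      B (WithLp.toLp 2 (0, (f t₀)⁻¹ • (Complex.I * p.2))) := by
    rw [modelDeriv_sliceTorus, sphereInclDeriv_modelDeriv_productTorus, he1, hy, map_zero,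
      torusLinear_apply, smul_zero, smul_smul, mul_inv_rev, mul_inv_cancel_left₀ h₂.ne']
  have ht : ∀ X, (modelDeriv ((𝓡 1).prod (𝓡 1)) (𝓘(ℝ, ℝ).prod (𝓡 3)) φ p X).1 = 0 := fun X => by
    rw [modelDeriv_sliceTorus]
  -- The unit normal of the torus in the round sphere: rotating the position `(r₁ p₁, r₂ p₂)` in the
  -- plane of `(p₁, 0)` and `(0, p₂)` by a right angle.
  obtain ⟨n, hn⟩ := exists_sphereInclDeriv_eq (n := 3) (productTorus B r₁ r₂ h p)
    (z := B (WithLp.toLp 2 (r₂ • (p.1 : ℂ), (-r₁) • (p.2 : ℂ)))) (by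
      change ⟪torusLinear B r₁ r₂ (p.1, p.2), _⟫_ℝ = 0
      rw [torusLinear_apply, inner_map_toLp]
      simp only [real_inner_smul_left, real_inner_smul_right, real_inner_self_eq_norm_sq,
        Circle.norm_coe]
      ring)
  set c := (r₁ ^ 2 - r₂ ^ 2) / (r₁ * r₂) with hc
  obtain ⟨Hv, hHv⟩ : ∃ Hv, Hv = g.meanCurvature ((𝓡 1).prod (𝓡 1)) φ p e := ⟨_, rfl⟩
  -- `Hv` and the expected vector `(f'/f, (c/(2f²)) n)` have equal scalar products with every `w`,
  -- which is all that is needed below.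
  have key : ∀ w, g.modelVal (φ p) Hv w =
      g.modelVal (φ p) (deriv f t₀ / f t₀, (c / (2 * f t₀ ^ 2)) • n) w := by
    intro w
    obtain ⟨a, b, hab, hperp⟩ := exists_sphereInclDeriv_productTorus_eq B h p w.2
    rw [hHv, SemiRiemannianMetric.modelVal_meanCurvature]
    have hr : g.modelVal (φ p) (deriv f t₀ / f t₀, (c / (2 * f t₀ ^ 2)) • n) w =
        c / 2 * (r₂ * ⟪(p.1 : ℂ), a⟫_ℝ - r₁ * ⟪(p.2 : ℂ), b⟫_ℝ) -
          deriv f t₀ / f t₀ * w.1 := by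
      have h1 : f t₀ ^ 2 * ⟪sphereInclDeriv (productTorus B r₁ r₂ h p) ((c / (2 * f t₀ ^ 2)) • n),
          sphereInclDeriv (productTorus B r₁ r₂ h p) w.2⟫_ℝ =
          c / 2 * (r₂ * ⟪(p.1 : ℂ), a⟫_ℝ - r₁ * ⟪(p.2 : ℂ), b⟫_ℝ) := by
        rw [map_smul, hn, hab, real_inner_smul_left, inner_map_toLp, real_inner_smul_left,
          real_inner_smul_left]
        field_simp
        ring
      exact congrArg (· - deriv f t₀ / f t₀ * w.1) h1
    rw [hr]
    simp only [Fin.sum_univ_two]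
    -- After `Circle.inner_eq`, the `i p₁` and `i p₂` components of `d₁` and `d₂` cancel against the
    -- tangential projection.
    rw [hC0 w a b hab, hC1 w a b hab, hD0 w a b hab, hD1 w a b hab, hC0 _ _ _ hw0, hC1 _ _ _ hw0,
      hC0 _ _ _ hw1, hC1 _ _ _ hw1, ht, ht, Circle.inner_eq p.1 d₁ a, Circle.inner_eq p.2 d₂ b,
      hd₁', hd₂', real_inner_smul_right, real_inner_smul_right, inner_zero_right, inner_zero_right,
      real_inner_comm _ d₁, real_inner_comm _ d₂]
    -- Tangency of `B (a, b)` to the sphere leaves one free normal coordinate, so both sides become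
    -- multiples of `⟪p₂, b⟫`.
    have hpa : ⟪(p.1 : ℂ), a⟫_ℝ = -(r₂ / r₁ * ⟪(p.2 : ℂ), b⟫_ℝ) := by
      field_simp
      linarith
    rw [hpa, hc]
    field_simp
    linear_combination f t₀ * ⟪(p.2 : ℂ), b⟫_ℝ * (r₁ ^ 2 - r₂ ^ 2) * h
  refine ⟨Hv, g.isMeanCurvatureVector_meanCurvature _ φ p e horth hHv, ?_, ?_⟩
  · have hsymm : ∀ a b, g.modelVal (φ p) a b = g.modelVal (φ p) b a := g.symm (φ p)
    have hn' : ‖sphereInclDeriv (productTorus B r₁ r₂ h p) n‖ ^ 2 = 1 := by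
      rw [hn, ← real_inner_self_eq_norm_sq, inner_map_toLp]
      simp only [real_inner_self_eq_norm_sq, norm_smul, Circle.norm_coe, Real.norm_eq_abs, mul_pow,
        sq_abs]
      linarith
    -- Applying `key` in each slot replaces `g(Hv, Hv)` by the square of the explicit vector.
    rw [key, hsymm, key, modelVal_flrwMetric]
    simp only [map_smul]
    rw [real_inner_smul_left, real_inner_smul_right, real_inner_self_eq_norm_sq]
    erw [hn']
    change f t₀ ^ 2 * _ - _ = _
    field_simp
  · rw [key, modelVal_flrwMetric]
    simp [hφ, sliceTorus]

end TorusFrame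

/-! ### Vector product in `ℂ × ℝ`. -/

section CrossProduct

theorem CR.ext {p q : CR} (h₁ : p.fst = q.fst) (h₂ : p.snd = q.snd) : p = q :=
  WithLp.ofLp_injective 2 (Prod.ext h₁ h₂)

theorem CR.inner_eq (p q : CR) :
    ⟪p, q⟫_ℝ = p.fst.re * q.fst.re + p.fst.im * q.fst.im + p.snd * q.snd := by
  rw [WithLp.prod_inner_apply]
  change ⟪p.fst, q.fst⟫_ℝ + ⟪p.snd, q.snd⟫_ℝ = _
  simp [Complex.inner, mul_comm]

theorem crossCR_fst_re (p q : CR) :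
    (crossCR p q).fst.re = p.fst.im * q.snd - p.snd * q.fst.im := by
  simp [crossCR]
  ring

theorem crossCR_fst_im (p q : CR) :
    (crossCR p q).fst.im = p.snd * q.fst.re - p.fst.re * q.snd := by
  simp [crossCR]
  ring

theorem crossCR_snd (p q : CR) :
    (crossCR p q).snd = p.fst.re * q.fst.im - p.fst.im * q.fst.re := by
  simp [crossCR]
  ring

/-- The vector product, as a continuous bilinear map. -/
def crossBilin : CR →L[ℝ] CR →L[ℝ] CR :=
  LinearMap.toContinuousBilinearMap <| LinearMap.mk₂ ℝ crossCR
    (fun p p' q => CR.ext (Complex.ext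
      (by simp [crossCR_fst_re]; ring) (by simp [crossCR_fst_im]; ring))
      (by simp [crossCR_snd]; ring))
    (fun c p q => CR.ext (Complex.ext
      (by simp [crossCR_fst_re]; ring) (by simp [crossCR_fst_im]; ring))
      (by simp [crossCR_snd]; ring))
    (fun p q q' => CR.ext (Complex.ext
      (by simp [crossCR_fst_re]; ring) (by simp [crossCR_fst_im]; ring))
      (by simp [crossCR_snd]; ring))
    (fun c p q => CR.ext (Complex.ext
      (by simp [crossCR_fst_re]; ring) (by simp [crossCR_fst_im]; ring))
      (by simp [crossCR_snd]; ring))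

theorem crossBilin_apply (p q : CR) : crossBilin p q = crossCR p q := rfl

theorem inner_crossCR_left (p q : CR) : ⟪p, crossCR p q⟫_ℝ = 0 := by
  rw [CR.inner_eq, crossCR_fst_re, crossCR_fst_im, crossCR_snd]
  ring

theorem inner_crossCR_right (p q : CR) : ⟪q, crossCR p q⟫_ℝ = 0 := by
  rw [CR.inner_eq, crossCR_fst_re, crossCR_fst_im, crossCR_snd]
  ring

theorem inner_crossCR_self (p q : CR) :
    ⟪crossCR p q, crossCR p q⟫_ℝ = ⟪p, p⟫_ℝ * ⟪q, q⟫_ℝ - ⟪p, q⟫_ℝ ^ 2 := by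
  simp only [CR.inner_eq, crossCR_fst_re, crossCR_fst_im, crossCR_snd]
  ring

theorem crossCR_self (p : CR) : crossCR p p = 0 :=
  CR.ext (Complex.ext (by rw [crossCR_fst_re]; simp; ring) (by rw [crossCR_fst_im]; simp; ring))
    (by rw [crossCR_snd]; simp; ring)

theorem crossCR_crossCR (p q : CR) :
    crossCR p (crossCR p q) = ⟪p, q⟫_ℝ • p - ⟪p, p⟫_ℝ • q := by
  rw [CR.inner_eq, CR.inner_eq]
  exact CR.ext
    (Complex.ext
      (by rw [crossCR_fst_re, crossCR_fst_im, crossCR_snd]; simp; ring)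
      (by rw [crossCR_fst_im, crossCR_fst_re, crossCR_snd]; simp; ring))
    (by rw [crossCR_snd, crossCR_fst_re, crossCR_fst_im]; simp; ring)

theorem finrank_CR : Module.finrank ℝ CR = 3 := by
  rw [(WithLp.linearEquiv 2 ℝ (ℂ × ℝ)).finrank_eq]
  simp [Complex.finrank_real_complex]

/-- Expansion of a vector orthogonal to the third vector of an orthonormal basis. -/
theorem eq_of_orthonormal_of_inner_eq_zero {u v w q : CR} (hu : ⟪u, u⟫_ℝ = 1) (hv : ⟪v, v⟫_ℝ = 1)
    (hw : ⟪w, w⟫_ℝ = 1) (huv : ⟪u, v⟫_ℝ = 0) (huw : ⟪u, w⟫_ℝ = 0) (hvw : ⟪v, w⟫_ℝ = 0)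
    (hq : ⟪w, q⟫_ℝ = 0) : q = ⟪u, q⟫_ℝ • u + ⟪v, q⟫_ℝ • v := by
  have hon : Orthonormal ℝ ![u, v, w] := by
    rw [orthonormal_iff_ite]
    intro i j
    fin_cases i <;> fin_cases j
    exacts [hu, huv, huw, (real_inner_comm _ _).trans huv, hv, hvw, (real_inner_comm _ _).trans huw,
      (real_inner_comm _ _).trans hvw, hw]
  have hc : Fintype.card (Fin 3) = Module.finrank ℝ CR := by rw [finrank_CR, Fintype.card_fin]
  let b : OrthonormalBasis (Fin 3) ℝ CR := OrthonormalBasis.mk hon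
    (by
      rw [← coe_basisOfOrthonormalOfCardEqFinrank hon hc]
      exact (basisOfOrthonormalOfCardEqFinrank hon hc).span_eq.ge)
  have h := b.sum_repr' q
  rw [Fin.sum_univ_three] at h
  simpa [b, hq] using h.symm

end CrossProduct

/-! ### Circles as plane sections of the two-sphere. -/

namespace IsCircleOfGeodesicCurvature

variable {γ : ℝ → CR} {c : ℝ}

theorem hasDerivAt (hγ : IsCircleOfGeodesicCurvature γ c) (s : ℝ) : HasDerivAt γ (deriv γ s) s :=
  (hγ.smooth.differentiable (by simp) s).hasDerivAt

theorem hasDerivAt_deriv (hγ : IsCircleOfGeodesicCurvature γ c) (s : ℝ) :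
    HasDerivAt (deriv γ) (deriv (deriv γ) s) s := by
  have h : ContDiff ℝ ∞ (deriv γ) := ((contDiff_infty_iff_deriv).1 hγ.smooth).2
  exact (h.differentiable (by simp) s).hasDerivAt

theorem inner_self (hγ : IsCircleOfGeodesicCurvature γ c) (s : ℝ) : ⟪γ s, γ s⟫_ℝ = 1 / 4 := by
  have h := hγ.mem_sphere s
  rw [mem_sphere_zero_iff_norm] at h
  rw [real_inner_self_eq_norm_sq, h]
  norm_num

theorem inner_deriv_self (hγ : IsCircleOfGeodesicCurvature γ c) (s : ℝ) :
    ⟪deriv γ s, deriv γ s⟫_ℝ = 1 := by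
  rw [real_inner_self_eq_norm_sq, hγ.unit_speed, one_pow]

theorem inner_deriv (hγ : IsCircleOfGeodesicCurvature γ c) (s : ℝ) : ⟪γ s, deriv γ s⟫_ℝ = 0 := by
  have h := (hγ.hasDerivAt s).inner ℝ (hγ.hasDerivAt s)
  have h2 : (fun t => ⟪γ t, γ t⟫_ℝ) = fun _ => 1 / 4 := funext hγ.inner_self
  rw [h2] at h
  have h3 := h.unique (hasDerivAt_const s _)
  rw [real_inner_comm (γ s) (deriv γ s)] at h3
  linarith

theorem inner_deriv_deriv (hγ : IsCircleOfGeodesicCurvature γ c) (s : ℝ) :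
    ⟪deriv (deriv γ) s, γ s⟫_ℝ = -1 := by
  have h := (hγ.hasDerivAt s).inner ℝ (hγ.hasDerivAt_deriv s)
  have h2 : (fun t => ⟪γ t, deriv γ t⟫_ℝ) = fun _ => 0 := funext hγ.inner_deriv
  rw [h2] at h
  have h3 := h.unique (hasDerivAt_const s _)
  rw [hγ.inner_deriv_self, real_inner_comm] at h3
  linarith

/-- The Frenet equation of a circle. -/
theorem deriv_deriv (hγ : IsCircleOfGeodesicCurvature γ c) (s : ℝ) :
    deriv (deriv γ) s = c • crossCR ((2 : ℝ) • γ s) (deriv γ s) - (4 : ℝ) • γ s := by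
  rw [← hγ.curvature s, real_inner_smul_right, hγ.inner_deriv_deriv]
  module

/-- The axis `2 c γ + 4 γ × γ'` of a circle is constant. -/
theorem axis_const (hγ : IsCircleOfGeodesicCurvature γ c) (s : ℝ) :
    (2 * c) • γ s + (2 : ℝ) • crossCR ((2 : ℝ) • γ s) (deriv γ s) =
      (2 * c) • γ 0 + (2 : ℝ) • crossCR ((2 : ℝ) • γ 0) (deriv γ 0) := by
  have hd : ∀ t, HasDerivAt
      (fun t => (2 * c) • γ t + (2 : ℝ) • crossCR ((2 : ℝ) • γ t) (deriv γ t)) 0 t := by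
    intro t
    have hu : HasDerivAt (fun t => (2 : ℝ) • γ t) ((2 : ℝ) • deriv γ t) t :=
      (hγ.hasDerivAt t).const_smul (2 : ℝ)
    have h1 : HasDerivAt (fun t => crossBilin ((2 : ℝ) • γ t) (deriv γ t))
        (crossBilin ((2 : ℝ) • γ t) (deriv (deriv γ) t) +
          crossBilin ((2 : ℝ) • deriv γ t) (deriv γ t)) t :=
      crossBilin.hasDerivAt_of_bilinear (fun _ => hu) (fun _ => hγ.hasDerivAt_deriv t)
    -- Crossing twice with the unit normal `2γ` is minus the identity on tangent vectors, and the
    -- component of `γ''` along `γ` drops out.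
    have h2 : crossBilin ((2 : ℝ) • γ t) (deriv (deriv γ) t) = -c • deriv γ t := by
      have e₁ : crossBilin ((2 : ℝ) • γ t) (crossCR ((2 : ℝ) • γ t) (deriv γ t)) = -deriv γ t := by
        rw [crossBilin_apply, crossCR_crossCR, real_inner_smul_left, hγ.inner_deriv,
          real_inner_smul_left, real_inner_smul_right, hγ.inner_self]
        module
      have e₂ : crossBilin ((2 : ℝ) • γ t) ((4 : ℝ) • γ t) = 0 := by
        rw [show (4 : ℝ) • γ t = (2 : ℝ) • (2 : ℝ) • γ t by module,
          (crossBilin ((2 : ℝ) • γ t)).map_smul, crossBilin_apply, crossCR_self, smul_zero]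
      rw [hγ.deriv_deriv t, map_sub, (crossBilin ((2 : ℝ) • γ t)).map_smul c, e₁, e₂]
      module
    have h3 : crossBilin ((2 : ℝ) • deriv γ t) (deriv γ t) = 0 := by
      rw [map_smul, smul_apply, crossBilin_apply, crossCR_self, smul_zero]
    rw [h2, h3, add_zero] at h1
    have h4 := ((hγ.hasDerivAt t).const_smul (2 * c)).add (h1.const_smul (2 : ℝ))
    have h5 : (2 * c) • deriv γ t + (2 : ℝ) • (-c • deriv γ t) = 0 := by module
    rw [h5] at h4
    exact h4
  exact is_const_of_deriv_eq_zero (fun t => (hd t).differentiableAt) (fun t => (hd t).deriv) s 0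

/-- A circle lies in a plane, and is the whole intersection of this plane with the sphere. -/
theorem exists_axis (hγ : IsCircleOfGeodesicCurvature γ c) :
    ∃ A : CR, ‖A‖ ^ 2 = 4 + c ^ 2 ∧
    ∀ p : CR, p ∈ range γ ↔ ‖p‖ = 1 / 2 ∧ ⟪A, p⟫_ℝ = c / 2 := by
  obtain ⟨A, hA⟩ : ∃ A, A = (2 * c) • γ 0 + (2 : ℝ) • crossCR ((2 : ℝ) • γ 0) (deriv γ 0) :=
    ⟨_, rfl⟩
  have hA' : ∀ s, A = (2 * c) • γ s + (2 : ℝ) • crossCR ((2 : ℝ) • γ s) (deriv γ s) :=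
    fun s => hA.trans (hγ.axis_const s).symm
  have hAγ : ∀ s, ⟪A, γ s⟫_ℝ = c / 2 := by
    intro s
    have h1 := inner_crossCR_left ((2 : ℝ) • γ s) (deriv γ s)
    rw [real_inner_smul_left, real_inner_comm] at h1
    rw [hA' s, inner_add_left, real_inner_smul_left, real_inner_smul_left, hγ.inner_self]
    linarith
  have hAT : ∀ s, ⟪A, deriv γ s⟫_ℝ = 0 := by
    intro s
    have h1 := inner_crossCR_right ((2 : ℝ) • γ s) (deriv γ s)
    rw [real_inner_comm] at h1
    rw [hA' s, inner_add_left, real_inner_smul_left, real_inner_smul_left, hγ.inner_deriv, h1]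
    ring
  have hAA : ⟪A, A⟫_ℝ = 4 + c ^ 2 := by
    have h1 := inner_crossCR_left ((2 : ℝ) • γ 0) (deriv γ 0)
    have h2 := inner_crossCR_self ((2 : ℝ) • γ 0) (deriv γ 0)
    have h3 : ⟪A, crossCR ((2 : ℝ) • γ 0) (deriv γ 0)⟫_ℝ = 2 := by
      rw [real_inner_smul_left] at h1
      rw [hA, inner_add_left, real_inner_smul_left, real_inner_smul_left, h2, real_inner_smul_left,
        real_inner_smul_left, real_inner_smul_right, hγ.inner_self, hγ.inner_deriv_self,
        hγ.inner_deriv]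
      linear_combination c * h1
    nth_rewrite 2 [hA]
    rw [inner_add_right, real_inner_smul_right, real_inner_smul_right, hAγ, h3]
    ring
  refine ⟨A, by rw [← real_inner_self_eq_norm_sq, hAA], fun p => ⟨?_, ?_⟩⟩
  · rintro ⟨s, rfl⟩
    exact ⟨mem_sphere_zero_iff_norm.1 (hγ.mem_sphere s), hAγ s⟩
  rintro ⟨hp1, hp2⟩
  obtain ⟨k, hk, hk2⟩ : ∃ k : ℝ, 0 < k ∧ k ^ 2 = 4 + c ^ 2 :=
    ⟨√(4 + c ^ 2), by positivity, Real.sq_sqrt (by positivity)⟩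
  -- The Euclidean centre of the circle: the foot of the perpendicular from the origin to the plane
  -- `⟪A, p⟫ = c/2`. Around it `γ` is a harmonic oscillator of angular speed `k`.
  obtain ⟨m, hm⟩ : ∃ m : CR, m = (c / (2 * k ^ 2)) • A := ⟨_, rfl⟩
  have hT : ∀ s, deriv (deriv γ) s = -(k ^ 2) • (γ s - m) := by
    intro s
    have h1 : crossCR ((2 : ℝ) • γ s) (deriv γ s) = (1 / 2 : ℝ) • A - c • γ s := by
      rw [hA' s]
      module
    have h2 : (k ^ 2) • m = (c / 2) • A := by
      rw [hm, smul_smul]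
      congr 1
      field_simp
    have h3 : -(k ^ 2) • (γ s - m) = (k ^ 2) • m - (k ^ 2) • γ s := by module
    rw [hγ.deriv_deriv s, h1, h3, h2, hk2]
    module
  have hcos : ∀ s, HasDerivAt (fun s => Real.cos (k * s)) (-Real.sin (k * s) * k) s := fun s => by
    simpa using (hasDerivAt_id s).const_mul k |>.cos
  have hsin : ∀ s, HasDerivAt (fun s => Real.sin (k * s)) (Real.cos (k * s) * k) s := fun s => by
    simpa using (hasDerivAt_id s).const_mul k |>.sin
  -- Rotating the pair `(γ - m, γ'/k)` back by the angle `k s` gives two constants of motion, `hE1`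
  -- and `hE2`. Inverting the rotation solves the equation without a uniqueness theorem.
  have hE1 : ∀ s, Real.cos (k * s) • (γ s - m) - (Real.sin (k * s) / k) • deriv γ s = γ 0 - m := by
    intro s
    have hd : ∀ t, HasDerivAt (fun t => Real.cos (k * t) • (γ t - m) -
        (Real.sin (k * t) / k) • deriv γ t) 0 t := by
      intro t
      have h1 := ((hcos t).smul ((hγ.hasDerivAt t).sub_const m)).sub
        (((hsin t).div_const k).smul (hγ.hasDerivAt_deriv t))
      have h2 : Real.cos (k * t) • deriv γ t + (-Real.sin (k * t) * k) • (γ t - m) -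
          ((Real.sin (k * t) / k) • deriv (deriv γ) t +
            (Real.cos (k * t) * k / k) • deriv γ t) = 0 := by
        rw [hT t, smul_smul, mul_div_assoc, div_self hk.ne',
          show Real.sin (k * t) / k * -(k ^ 2) = -Real.sin (k * t) * k by field_simp]
        module
      rw [h2] at h1
      exact h1
    have h :=
      is_const_of_deriv_eq_zero (fun t => (hd t).differentiableAt) (fun t => (hd t).deriv) s 0
    simpa using h
  have hE2 : ∀ s, Real.sin (k * s) • (γ s - m) + (Real.cos (k * s) / k) • deriv γ s =
      (1 / k) • deriv γ 0 := by
    intro s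
    have hd : ∀ t, HasDerivAt (fun t => Real.sin (k * t) • (γ t - m) +
        (Real.cos (k * t) / k) • deriv γ t) 0 t := by
      intro t
      have h1 := ((hsin t).smul ((hγ.hasDerivAt t).sub_const m)).add
        (((hcos t).div_const k).smul (hγ.hasDerivAt_deriv t))
      have h2 : Real.sin (k * t) • deriv γ t + (Real.cos (k * t) * k) • (γ t - m) +
          ((Real.cos (k * t) / k) • deriv (deriv γ) t +
            (-Real.sin (k * t) * k / k) • deriv γ t) = 0 := by
        rw [hT t, smul_smul, mul_div_assoc, div_self hk.ne',
          show Real.cos (k * t) / k * -(k ^ 2) = -(Real.cos (k * t) * k) by field_simp]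
        module
      rw [h2] at h1
      exact h1
    have h :=
      is_const_of_deriv_eq_zero (fun t => (hd t).differentiableAt) (fun t => (hd t).deriv) s 0
    simpa using h
  have hsol : ∀ s, γ s - m =
      Real.cos (k * s) • (γ 0 - m) + (Real.sin (k * s) / k) • deriv γ 0 := by
    intro s
    have h1 : (Real.sin (k * s) / k) • deriv γ 0 = Real.sin (k * s) • (1 / k) • deriv γ 0 := by
      rw [smul_smul, mul_one_div]
    rw [h1, ← hE2 s, ← hE1 s]
    have h2 := Real.cos_sq_add_sin_sq (k * s)
    match_scalars
    · linear_combination -h2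
    · linear_combination h2
    · ring
  have hmA : ⟪A, m⟫_ℝ = c / 2 := by
    rw [hm, real_inner_smul_right, hAA, ← hk2]
    field_simp
  have hnorm : ∀ q : CR, ⟪q, q⟫_ℝ = 1 / 4 → ⟪A, q⟫_ℝ = c / 2 → ⟪q - m, q - m⟫_ℝ = 1 / k ^ 2 := by
    intro q h1 h2
    have h3 : ⟪m, q⟫_ℝ = c / (2 * k ^ 2) * (c / 2) := by
      rw [hm, real_inner_smul_left, h2]
    have h4 : ⟪m, m⟫_ℝ = c / (2 * k ^ 2) * (c / 2) := by
      nth_rewrite 1 [hm]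
      rw [real_inner_smul_left, hmA]
    rw [inner_sub_left, inner_sub_right, inner_sub_right, real_inner_comm m q, h1, h3, h4]
    field_simp
    linarith
  have hpp : ⟪p, p⟫_ℝ = 1 / 4 := by
    rw [real_inner_self_eq_norm_sq, hp1]
    norm_num
  have hq := hnorm p hpp hp2
  have hq0 := hnorm (γ 0) (hγ.inner_self 0) (hAγ 0)
  -- The vector `p - m` is orthogonal to the axis, hence lies in the plane of the initial radius and
  -- velocity. Its length `1/k` then makes `(kx, ky)` a unit vector, whose angle gives the time at
  -- which `γ` reaches `p`.
  have hexp := eq_of_orthonormal_of_inner_eq_zero (u := k • (γ 0 - m)) (v := deriv γ 0)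
    (w := (1 / k) • A) (q := p - m)
    (by rw [real_inner_smul_left, real_inner_smul_right, hq0]; field_simp)
    (hγ.inner_deriv_self 0)
    (by rw [real_inner_smul_left, real_inner_smul_right, hAA, ← hk2]; field_simp)
    (by rw [real_inner_smul_left, inner_sub_left, hγ.inner_deriv, hm, real_inner_smul_left, hAT]
        simp)
    (by rw [real_inner_smul_left, real_inner_smul_right, real_inner_comm, inner_sub_right, hAγ, hmA]
        simp)
    (by rw [real_inner_smul_right, real_inner_comm, hAT, mul_zero])
    (by rw [real_inner_smul_left, inner_sub_right, hp2, hmA, sub_self, mul_zero])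
  obtain ⟨x, hx⟩ : ∃ x, x = ⟪k • (γ 0 - m), p - m⟫_ℝ := ⟨_, rfl⟩
  obtain ⟨y, hy⟩ : ∃ y, y = ⟪deriv γ 0, p - m⟫_ℝ := ⟨_, rfl⟩
  rw [← hx, ← hy] at hexp
  have hxy : k ^ 2 * (x ^ 2 + y ^ 2) = 1 := by
    have h1 : ⟪p - m, p - m⟫_ℝ = x * x + y * y := by
      nth_rewrite 1 [hexp]
      rw [inner_add_left, real_inner_smul_left (k • (γ 0 - m)) (p - m) x,
        real_inner_smul_left (deriv γ 0) (p - m) y, ← hx, ← hy]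
    rw [hq] at h1
    have h2 : x ^ 2 + y ^ 2 = 1 / k ^ 2 := by rw [h1]; ring
    rw [h2]
    field_simp
  obtain ⟨θ, hθ1, hθ2⟩ : ∃ θ, Real.cos θ = k * x ∧ Real.sin θ = k * y := by
    have hn : ‖(⟨k * x, k * y⟩ : ℂ)‖ = 1 := by
      rw [← sq_eq_sq₀ (norm_nonneg _) zero_le_one, ← Complex.normSq_eq_norm_sq,
        Complex.normSq_mk]
      linarith
    have hne : (⟨k * x, k * y⟩ : ℂ) ≠ 0 := norm_pos_iff.1 (hn ▸ one_pos)
    exact ⟨Complex.arg ⟨k * x, k * y⟩, by rw [Complex.cos_arg hne, hn, div_one],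
      by rw [Complex.sin_arg, hn, div_one]⟩
  refine ⟨θ / k, ?_⟩
  have h := hsol (θ / k)
  rw [mul_div_cancel₀ _ hk.ne', hθ1, hθ2] at h
  have h2 : γ (θ / k) - m = p - m := by
    rw [h, hexp, smul_smul, mul_comm x k, mul_div_assoc, mul_div_cancel₀ _ hk.ne']
  exact sub_left_injective h2

end IsCircleOfGeodesicCurvature

/-! ### The Hopf map and its unitary symmetries. -/

section Hopf

theorem hopf_fst (q : S3) : (hopf q).fst = (q : CC).fst * starRingEnd ℂ (q : CC).snd := rfl

theorem hopf_snd (q : S3) : (hopf q).snd = (‖(q : CC).fst‖ ^ 2 - ‖(q : CC).snd‖ ^ 2) / 2 := rfl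

theorem S3.norm_sq_add_norm_sq (q : S3) : ‖(q : CC).fst‖ ^ 2 + ‖(q : CC).snd‖ ^ 2 = 1 := by
  rw [← WithLp.prod_norm_sq_eq_of_L2, norm_eq_of_mem_sphere, one_pow]

theorem norm_hopf (q : S3) : ‖hopf q‖ = 1 / 2 := by
  have h : ‖hopf q‖ ^ 2 = (1 / 2) ^ 2 := by
    rw [WithLp.prod_norm_sq_eq_of_L2, hopf_fst, hopf_snd, norm_mul, RCLike.norm_conj,
      Real.norm_eq_abs, sq_abs]
    linear_combination
      (1 / 4) * (‖(q : CC).fst‖ ^ 2 + ‖(q : CC).snd‖ ^ 2 + 1) * S3.norm_sq_add_norm_sq q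
  exact (sq_eq_sq₀ (norm_nonneg _) (by norm_num)).1 h

theorem exists_hopf_eq {p : CR} (hp : ‖p‖ = 1 / 2) : ∃ q : S3, hopf q = p := by
  have h : ‖p.fst‖ ^ 2 + p.snd ^ 2 = 1 / 4 := by
    have h1 := WithLp.prod_norm_sq_eq_of_L2 p
    rw [hp, Real.norm_eq_abs, sq_abs] at h1
    rw [← h1]
    norm_num
  have key : ∀ z w : ℂ, ‖z‖ ^ 2 + ‖w‖ ^ 2 = 1 → z * starRingEnd ℂ w = p.fst →
      (‖z‖ ^ 2 - ‖w‖ ^ 2) / 2 = p.snd → ∃ q : S3, hopf q = p := by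
    intro z w h1 h2 h3
    refine ⟨⟨WithLp.toLp 2 (z, w), ?_⟩, CR.ext h2 h3⟩
    rw [mem_sphere_zero_iff_norm, ← pow_eq_one_iff_of_nonneg (norm_nonneg _) two_ne_zero,
      WithLp.prod_norm_sq_eq_of_L2]
    exact h1
  -- The south pole is the image of `(0, 1)`. Elsewhere there is a preimage with real positive first
  -- coordinate `s`, and `s² = 1/2 + p.snd` is forced.
  rcases eq_or_ne p.snd (-(1 / 2)) with hx | hx
  · have h0 : p.fst = 0 := by
      rw [hx] at h
      have : ‖p.fst‖ ^ 2 = 0 := by linarith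
      exact norm_eq_zero.1 (pow_eq_zero_iff two_ne_zero |>.1 this)
    refine key 0 1 ?_ ?_ ?_ <;> norm_num [h0, hx]
  · have hpos : 0 < 1 / 2 + p.snd := by
      have h1 : -(1 / 2) ≤ p.snd := by nlinarith [sq_nonneg ‖p.fst‖]
      have h2 := lt_of_le_of_ne h1 hx.symm
      linarith
    obtain ⟨s, hs, hs2⟩ : ∃ s : ℝ, 0 < s ∧ s ^ 2 = 1 / 2 + p.snd :=
      ⟨√(1 / 2 + p.snd), Real.sqrt_pos.2 hpos, Real.sq_sqrt hpos.le⟩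
    have hz : ‖(s : ℂ)‖ ^ 2 = 1 / 2 + p.snd := by
      rw [Complex.norm_real, Real.norm_eq_abs, sq_abs, hs2]
    have hw : ‖starRingEnd ℂ p.fst / (s : ℂ)‖ ^ 2 = 1 / 2 - p.snd := by
      rw [norm_div, div_pow, hz, RCLike.norm_conj, div_eq_iff hpos.ne']
      linear_combination h
    have hs' : (s : ℂ) ≠ 0 := Complex.ofReal_ne_zero.2 hs.ne'
    refine key s (starRingEnd ℂ p.fst / s) ?_ ?_ ?_
    · rw [hz, hw]
      ring
    · rw [map_div₀, Complex.conj_conj, Complex.conj_ofReal]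
      field_simp
    · rw [hz, hw]
      ring

/-- The isometry `(a, b) ↦ (a z - b w̄, a w + b z̄)` of `ℂ²` which maps `(1, 0)` to
`e = (z, w) ∈ S3`. -/
def hopfIsometry (e : S3) : CC ≃ₗᵢ[ℝ] CC :=
  LinearIsometry.toLinearIsometryEquiv
    { toFun := fun q => WithLp.toLp 2
        (q.fst * (e : CC).fst - q.snd * starRingEnd ℂ (e : CC).snd,
          q.fst * (e : CC).snd + q.snd * starRingEnd ℂ (e : CC).fst)
      map_add' := fun p q => WithLp.ofLp_injective 2 (Prod.ext (by simp; ring) (by simp; ring))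
      map_smul' := fun c q => WithLp.ofLp_injective 2
        (Prod.ext (by simp [mul_sub, mul_assoc]) (by simp [mul_assoc]))
      norm_map' := fun q => by
        have h := S3.norm_sq_add_norm_sq e
        rw [← sq_eq_sq₀ (norm_nonneg _) (norm_nonneg _), WithLp.prod_norm_sq_eq_of_L2,
          WithLp.prod_norm_sq_eq_of_L2]
        change ‖q.fst * (e : CC).fst - q.snd * starRingEnd ℂ (e : CC).snd‖ ^ 2 +
          ‖q.fst * (e : CC).snd + q.snd * starRingEnd ℂ (e : CC).fst‖ ^ 2 = _
        simp only [← Complex.normSq_eq_norm_sq] at h ⊢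
        simp only [Complex.normSq_apply, Complex.add_re, Complex.add_im, Complex.sub_re,
          Complex.sub_im, Complex.mul_re, Complex.mul_im, Complex.conj_re, Complex.conj_im] at h ⊢
        linear_combination (q.fst.re * q.fst.re + q.fst.im * q.fst.im +
          (q.snd.re * q.snd.re + q.snd.im * q.snd.im)) * h }
    rfl

/-- A unitary map of `ℂ²` of determinant one covers a rotation of the base, so the scalar product
can be computed for `(1, 0)` and `(a, b)`: it is `1/2` times the height `(|a|² - |b|²)/2`. -/
theorem inner_hopf_hopfIsometry (e q : S3) (a b : ℂ)
    (hq : (q : CC) = hopfIsometry e (WithLp.toLp 2 (a, b))) :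
    4 * ⟪hopf e, hopf q⟫_ℝ = ‖a‖ ^ 2 - ‖b‖ ^ 2 := by
  have h := S3.norm_sq_add_norm_sq e
  have h1 : (q : CC).fst = a * (e : CC).fst - b * starRingEnd ℂ (e : CC).snd :=
    congrArg WithLp.fst hq
  have h2 : (q : CC).snd = a * (e : CC).snd + b * starRingEnd ℂ (e : CC).fst :=
    congrArg WithLp.snd hq
  rw [CR.inner_eq, hopf_snd, hopf_snd, hopf_fst, hopf_fst, h1, h2]
  simp only [← Complex.normSq_eq_norm_sq] at h ⊢
  simp only [Complex.normSq_apply, Complex.add_re, Complex.add_im, Complex.sub_re,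
    Complex.sub_im, Complex.mul_re, Complex.mul_im, Complex.conj_re, Complex.conj_im] at h ⊢
  linear_combination (a.re * a.re + a.im * a.im - (b.re * b.re + b.im * b.im)) *
    ((e : CC).fst.re * (e : CC).fst.re + (e : CC).fst.im * (e : CC).fst.im +
      ((e : CC).snd.re * (e : CC).snd.re + (e : CC).snd.im * (e : CC).snd.im) + 1) * h

end Hopf

theorem exists_circle_smul_eq {r : ℝ} (hr : 0 < r) {a : ℂ} (ha : ‖a‖ ^ 2 = r ^ 2) :
    ∃ u : Circle, r • (u : ℂ) = a := by
  have ha' : ‖a‖ = r := (sq_eq_sq₀ (norm_nonneg _) hr.le).1 ha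
  refine ⟨⟨r⁻¹ • a, ?_⟩, ?_⟩
  · change r⁻¹ • a ∈ sphere (0 : ℂ) 1
    rw [mem_sphere_zero_iff_norm, norm_smul, ha', norm_inv, Real.norm_of_nonneg hr.le,
      inv_mul_cancel₀ hr.ne']
  · exact smul_inv_smul₀ hr.ne' a

/-- The Hopf lift of a circle is a product torus. -/
theorem IsCircleOfGeodesicCurvature.exists_range_sliceTorus_eq {γ : ℝ → CR} {c : ℝ}
    (hγ : IsCircleOfGeodesicCurvature γ c) {U : TopologicalSpace.Opens ℝ} (t₀ : U) :
    ∃ (B : CC ≃ₗᵢ[ℝ] CC) (r₁ r₂ : ℝ) (h : r₁ ^ 2 + r₂ ^ 2 = 1), 0 < r₁ ∧ 0 < r₂ ∧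
      (r₁ ^ 2 - r₂ ^ 2) / (r₁ * r₂) = c ∧
      range (sliceTorus B r₁ r₂ t₀ h) = hopfLift t₀ (range γ) := by
  obtain ⟨A, hA, hmem⟩ := hγ.exists_axis
  obtain ⟨k, hk, hk2⟩ : ∃ k : ℝ, 0 < k ∧ k ^ 2 = 4 + c ^ 2 :=
    ⟨√(4 + c ^ 2), by positivity, Real.sq_sqrt (by positivity)⟩
  have hAk : ‖A‖ = k := (sq_eq_sq₀ (norm_nonneg _) hk.le).1 (hA.trans hk2.symm)
  -- The axis, rescaled to length `1/2`, is a point of the base; its fibre becomes the core circle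
  -- `b = 0`.
  obtain ⟨e, he⟩ := exists_hopf_eq (p := (2 * k)⁻¹ • A)
    (by rw [norm_smul, hAk, Real.norm_of_nonneg (by positivity)]; field_simp)
  have hck : |c| < k := by
    rw [← sq_lt_sq₀ (abs_nonneg c) hk.le, sq_abs]
    linarith
  obtain ⟨hck1, hck2⟩ := abs_lt.1 hck
  have hp1 : 0 < (1 + c / k) / 2 := by
    have : -1 < c / k := by rw [lt_div_iff₀ hk]; linarith
    linarith
  have hp2 : 0 < (1 - c / k) / 2 := by
    have : c / k < 1 := by rw [div_lt_iff₀ hk]; linarith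
    linarith
  -- The radii solve `r₁² + r₂² = 1` and `r₁² - r₂² = c/k`; both are positive because `|c| < k`.
  obtain ⟨r₁, hr₁, hr₁'⟩ : ∃ r : ℝ, 0 < r ∧ r ^ 2 = (1 + c / k) / 2 :=
    ⟨√_, Real.sqrt_pos.2 hp1, Real.sq_sqrt hp1.le⟩
  obtain ⟨r₂, hr₂, hr₂'⟩ : ∃ r : ℝ, 0 < r ∧ r ^ 2 = (1 - c / k) / 2 :=
    ⟨√_, Real.sqrt_pos.2 hp2, Real.sq_sqrt hp2.le⟩
  have h12 : r₁ * r₂ = 1 / k := by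
    rw [← sq_eq_sq₀ (by positivity) (by positivity), mul_pow, hr₁', hr₂']
    field_simp
    linarith
  have hiff : ∀ (q : S3) (a b : ℂ), (q : CC) = hopfIsometry e (WithLp.toLp 2 (a, b)) →
      (hopf q ∈ range γ ↔ ‖a‖ ^ 2 - ‖b‖ ^ 2 = c / k) := by
    intro q a b hq
    have h1 := inner_hopf_hopfIsometry e q a b hq
    rw [he, real_inner_smul_left] at h1
    rw [hmem, and_iff_right (norm_hopf q), ← h1]
    field_simp
    constructor <;> intro h <;> linarith
  refine ⟨hopfIsometry e, r₁, r₂, by rw [hr₁', hr₂']; ring, hr₁, hr₂, ?_, ?_⟩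
  · rw [h12, hr₁', hr₂']
    field_simp
    ring
  ext q
  constructor
  · rintro ⟨p, rfl⟩
    refine ⟨rfl, (hiff _ (r₁ • (p.1 : ℂ)) (r₂ • (p.2 : ℂ)) rfl).2 ?_⟩
    rw [norm_smul, norm_smul, Circle.norm_coe, Circle.norm_coe, Real.norm_of_nonneg hr₁.le,
      Real.norm_of_nonneg hr₂.le, mul_one, mul_one, hr₁', hr₂']
    ring
  · rintro ⟨hq1, hq2⟩
    obtain ⟨v, hv⟩ := (hopfIsometry e).surjective (q.2 : CC)
    have h1 := (hiff q.2 v.fst v.snd hv.symm).1 hq2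
    have h2 : ‖v.fst‖ ^ 2 + ‖v.snd‖ ^ 2 = 1 := by
      rw [← WithLp.prod_norm_sq_eq_of_L2, ← (hopfIsometry e).norm_map, hv, norm_eq_of_mem_sphere,
        one_pow]
    obtain ⟨u₁, hu₁⟩ := exists_circle_smul_eq hr₁ (a := v.fst) (by rw [hr₁']; linarith)
    obtain ⟨u₂, hu₂⟩ := exists_circle_smul_eq hr₂ (a := v.snd) (by rw [hr₂']; linarith)
    refine ⟨(u₁, u₂), Prod.ext hq1.symm (Subtype.ext ?_)⟩
    change torusLinear (hopfIsometry e) r₁ r₂ ((u₁ : ℂ), (u₂ : ℂ)) = _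
    rw [torusLinear_apply, hu₁, hu₂]
    exact hv

/-- In the two-sphere of radius `1/2` there are circles of every geodesic curvature. -/
theorem exists_isCircleOfGeodesicCurvature (c : ℝ) :
    ∃ γ : ℝ → CR, IsCircleOfGeodesicCurvature γ c := by
  obtain ⟨k, hk, hk2⟩ : ∃ k : ℝ, 0 < k ∧ k ^ 2 = 4 + c ^ 2 :=
    ⟨√(4 + c ^ 2), by positivity, Real.sq_sqrt (by positivity)⟩
  obtain ⟨E, hE⟩ : ∃ E : ℝ → ℂ, E = fun s : ℝ => Complex.exp ((k * s : ℝ) * Complex.I) := ⟨_, rfl⟩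
  have hEn : ∀ s, ‖E s‖ = 1 := fun s => by rw [hE]; exact Complex.norm_exp_ofReal_mul_I _
  have hEs : ∀ s, (E s).re ^ 2 + (E s).im ^ 2 = 1 := by
    intro s
    have h := Complex.normSq_eq_norm_sq (E s)
    rw [hEn, Complex.normSq_apply] at h
    linarith
  have hEd : ∀ s, HasDerivAt E (k * Complex.I * E s) s := by
    intro s
    have h1 : HasDerivAt (fun s : ℝ => ((k * s : ℝ) : ℂ) * Complex.I) (k * Complex.I) s := by
      simpa using (((hasDerivAt_id s).const_mul k).ofReal_comp).mul_const Complex.I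
    have h2 := h1.cexp
    rw [hE]
    convert h2 using 1
    ring
  have hEc : ContDiff ℝ ∞ E := by
    rw [hE]
    exact Complex.contDiff_exp.comp
      ((Complex.ofRealCLM.contDiff.comp (contDiff_const.mul contDiff_id)).mul contDiff_const)
  let L : ℂ × ℝ →L[ℝ] CR := (WithLp.prodContinuousLinearEquiv 2 ℝ ℂ ℝ).symm
  have hL1 : ∀ x, (L x).fst = x.1 := fun _ => rfl
  have hL2 : ∀ x, (L x).snd = x.2 := fun _ => rfl
  have hd0 : ∀ s, HasDerivAt (fun s => L (((1 / k : ℝ) : ℂ) * E s, c / (2 * k)))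
      (L (Complex.I * E s, 0)) s := by
    intro s
    have h1 := L.hasFDerivAt.comp_hasDerivAt s
      (((hEd s).const_mul ((1 / k : ℝ) : ℂ)).prodMk (hasDerivAt_const s (c / (2 * k))))
    have h2 : ((1 / k : ℝ) : ℂ) * (k * Complex.I * E s) = Complex.I * E s := by
      have : (k : ℂ) ≠ 0 := Complex.ofReal_ne_zero.2 hk.ne'
      push_cast
      field_simp
    rw [h2] at h1
    exact h1
  have hd1 : ∀ s, HasDerivAt (fun s => L (Complex.I * E s, 0))
      (L (-(k : ℂ) * E s, 0)) s := by
    intro s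
    have h1 := L.hasFDerivAt.comp_hasDerivAt s
      (((hEd s).const_mul Complex.I).prodMk (hasDerivAt_const s (0 : ℝ)))
    have h2 : Complex.I * (k * Complex.I * E s) = -(k : ℂ) * E s := by
      linear_combination (k : ℂ) * E s * Complex.I_mul_I
    rw [h2] at h1
    exact h1
  have he0 : deriv (fun s => L (((1 / k : ℝ) : ℂ) * E s, c / (2 * k))) =
      fun s => L (Complex.I * E s, 0) := funext fun s => (hd0 s).deriv
  have he1 : deriv (fun s => L (Complex.I * E s, 0)) = fun s => L (-(k : ℂ) * E s, 0) :=
    funext fun s => (hd1 s).deriv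
  -- The parallel of radius `1/k` at height `c/(2k)`, run through with angular speed `k` and hence
  -- unit speed. It lies on the sphere because `1/k² + c²/(4k²) = 1/4`.
  refine ⟨fun s => L (((1 / k : ℝ) : ℂ) * E s, c / (2 * k)), ?_, ?_, ?_, ?_⟩
  · exact L.contDiff.comp ((contDiff_const.mul hEc).prodMk contDiff_const)
  · intro s
    rw [mem_sphere_zero_iff_norm, ← sq_eq_sq₀ (norm_nonneg _) (by norm_num),
      WithLp.prod_norm_sq_eq_of_L2, hL1, hL2, norm_mul, hEn, Complex.norm_real, mul_one,
      Real.norm_eq_abs, Real.norm_eq_abs, sq_abs, sq_abs]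
    field_simp
    linarith
  · intro s
    rw [he0, ← pow_eq_one_iff_of_nonneg (norm_nonneg _) two_ne_zero,
      WithLp.prod_norm_sq_eq_of_L2, hL1, hL2, norm_mul, hEn, Complex.norm_I]
    simp
  · intro s
    have h := hEs s
    rw [he0, he1]
    have hi : ⟪L (-(k : ℂ) * E s, 0), (2 : ℝ) • L (((1 / k : ℝ) : ℂ) * E s, c / (2 * k))⟫_ℝ
        = -2 := by
      rw [real_inner_smul_right, CR.inner_eq]
      simp only [hL1, hL2, Complex.mul_re, Complex.mul_im, Complex.neg_re, Complex.neg_im,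
        Complex.ofReal_re, Complex.ofReal_im]
      field_simp
      linear_combination -2 * k * h
    rw [hi]
    have hc : c ^ 2 = k ^ 2 - 4 := by linarith
    refine CR.ext (Complex.ext ?_ ?_) ?_
    · rw [WithLp.smul_fst, Complex.smul_re, crossCR_fst_re]
      simp [hL1, hL2]
      field_simp
      linear_combination (E s).re * hc
    · rw [WithLp.smul_fst, Complex.smul_im, crossCR_fst_im]
      simp [hL1, hL2]
      field_simp
      linear_combination (E s).im * hc
    · rw [WithLp.smul_snd, smul_eq_mul, crossCR_snd]
      simp [hL1, hL2]
      field_simp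
      linear_combination -c * h

/-! ### Causal type of Hopf lifts and their number. -/

section CausalType

variable {U : TopologicalSpace.Opens ℝ} {f : ℝ → ℝ} (hf : ContDiffOn ℝ ∞ f U)
  (hpos : ∀ t ∈ U, 0 < f t)

/-- The Hopf lift of a circle is an embedded spacelike torus with a nowhere vanishing mean
curvature vector `H` such that `g(H, H) = ((c / 2)² - f'²) / f²`. -/
theorem exists_torus_hopfLift (t₀ : U) (ht₀ : deriv f t₀ ≠ 0) {c : ℝ} {γ : ℝ → CR}
    (hγ : IsCircleOfGeodesicCurvature γ c) :
    IsEmbeddedTorusWith (fun φ => (flrwMetric U f hf hpos).IsSpacelike ((𝓡 1).prod (𝓡 1)) φ ∧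
      ∀ p, ∃ Hv, (flrwMetric U f hf hpos).IsMeanCurvatureVector ((𝓡 1).prod (𝓡 1)) φ p Hv ∧
        (flrwMetric U f hf hpos).val (φ p) Hv Hv = ((c / 2) ^ 2 - deriv f t₀ ^ 2) / f t₀ ^ 2 ∧
        Hv ≠ 0) (hopfLift t₀ (range γ)) := by
  obtain ⟨B, r₁, r₂, h, h₁, h₂, hc, hrange⟩ := hγ.exists_range_sliceTorus_eq t₀
  refine ⟨sliceTorus B r₁ r₂ t₀ h, isSmoothEmbedding_sliceTorus B h t₀ h₁.ne' h₂.ne', hrange,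
    isSpacelike_sliceTorus B h hf hpos t₀ h₁.ne' h₂.ne', fun p => ?_⟩
  obtain ⟨Hv, hH, hval, htime⟩ := exists_isMeanCurvatureVector_sliceTorus B h hf hpos t₀ h₁ h₂ p
  refine ⟨Hv, hH, hc ▸ hval, fun h0 => ?_⟩
  -- A zero vector would pair to zero with `∂ₜ`, but this pairing is `-f'/f`.
  have h3 : (flrwMetric U f hf hpos).modelVal (sliceTorus B r₁ r₂ t₀ h p) Hv (1, 0) = 0 := by
    rw [show Hv = (0 : ℝ × EuclideanSpace ℝ (Fin 3)) from h0, map_zero]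
    rfl
  rw [htime, neg_eq_zero, div_eq_zero_iff] at h3
  exact h3.elim ht₀ (hpos t₀ t₀.2).ne'

theorem isMarginallyTrappedTorus_hopfLift (t₀ : U) (ht₀ : deriv f t₀ ≠ 0) {c : ℝ} {γ : ℝ → CR}
    (hγ : IsCircleOfGeodesicCurvature γ c) (hc : c = 2 * |deriv f t₀|) :
    IsMarginallyTrappedTorus (flrwMetric U f hf hpos) (hopfLift t₀ (range γ)) := by
  obtain ⟨φ, hφ, hr, hs, hH⟩ := exists_torus_hopfLift hf hpos t₀ ht₀ hγ
  refine ⟨φ, hφ, hr, hs, fun p => ?_⟩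
  obtain ⟨Hv, hHv, hval, hne⟩ := hH p
  refine ⟨Hv, hHv, ?_, hne⟩
  rw [hval, hc, mul_div_cancel_left₀ _ two_ne_zero, sq_abs, sub_self, zero_div]

theorem isUntrappedTorus_hopfLift (t₀ : U) (ht₀ : deriv f t₀ ≠ 0) {c : ℝ} {γ : ℝ → CR}
    (hγ : IsCircleOfGeodesicCurvature γ c) (hc : 2 * |deriv f t₀| < c) :
    IsUntrappedTorus (flrwMetric U f hf hpos) (hopfLift t₀ (range γ)) := by
  obtain ⟨φ, hφ, hr, hs, hH⟩ := exists_torus_hopfLift hf hpos t₀ ht₀ hγ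
  refine ⟨φ, hφ, hr, hs, fun p => ?_⟩
  obtain ⟨Hv, hHv, hval, -⟩ := hH p
  refine ⟨Hv, hHv, ?_⟩
  have h := hpos t₀ t₀.2
  rw [hval, ← sq_abs (deriv f t₀)]
  have h2 : |deriv f t₀| ^ 2 < (c / 2) ^ 2 :=
    pow_lt_pow_left₀ (by linarith) (abs_nonneg _) two_ne_zero
  exact div_pos (sub_pos.2 h2) (by positivity)

theorem isTrappedTorus_hopfLift (t₀ : U) (ht₀ : deriv f t₀ ≠ 0) {c : ℝ} {γ : ℝ → CR}
    (hγ : IsCircleOfGeodesicCurvature γ c) (hc₀ : 0 ≤ c) (hc : c < 2 * |deriv f t₀|) :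
    IsTrappedTorus (flrwMetric U f hf hpos) (hopfLift t₀ (range γ)) := by
  obtain ⟨φ, hφ, hr, hs, hH⟩ := exists_torus_hopfLift hf hpos t₀ ht₀ hγ
  refine ⟨φ, hφ, hr, hs, fun p => ?_⟩
  obtain ⟨Hv, hHv, hval, -⟩ := hH p
  refine ⟨Hv, hHv, ?_⟩
  have h := hpos t₀ t₀.2
  rw [hval, ← sq_abs (deriv f t₀)]
  have h2 : (c / 2) ^ 2 < |deriv f t₀| ^ 2 :=
    pow_lt_pow_left₀ (by linarith) (by linarith) two_ne_zero
  exact div_neg_of_neg_of_pos (sub_neg.2 h2) (by positivity)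

end CausalType

/-- Hopf lifts of circles at different levels are different. -/
theorem injective_hopfLift {ι : Type*} {U : TopologicalSpace.Opens ℝ} {t : ι → U}
    (ht : Function.Injective t) {γ : ι → ℝ → CR} {c : ι → ℝ}
    (hγ : ∀ i, IsCircleOfGeodesicCurvature (γ i) (c i)) :
    Function.Injective fun i => hopfLift (t i) (range (γ i)) := by
  intro i j hij
  -- Surjectivity of the Hopf map makes the lift nonempty, and any of its points reveals the level.
  obtain ⟨q, hq⟩ := exists_hopf_eq (mem_sphere_zero_iff_norm.1 ((hγ i).mem_sphere 0))
  have h1 : (t i, q) ∈ hopfLift (t i) (range (γ i)) := ⟨rfl, 0, hq.symm⟩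
  have h2 : (t i, q) ∈ hopfLift (t j) (range (γ j)) := hij.le h1
  exact ht h2.1

theorem exists_deriv_ne_zero_of_not_const {U : TopologicalSpace.Opens ℝ}
    (hU : IsPreconnected (U : Set ℝ)) {f : ℝ → ℝ} (hf : ContDiffOn ℝ ∞ f U)
    (hconst : ¬ ∃ k : ℝ, ∀ t ∈ U, f t = k) : ∃ t₀ : U, deriv f t₀ ≠ 0 := by
  by_contra! h
  refine hconst ?_
  obtain ⟨a, ha⟩ := U.isOpen.exists_is_const_of_deriv_eq_zero hU (hf.differentiableOn (by simp))
    fun t ht => h ⟨t, ht⟩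
  exact ⟨a, ha⟩

/-- By continuity of `f'`, one level with `f' ≠ 0` has a whole neighbourhood of such levels, and
neighbourhoods in `ℝ` are infinite. -/
theorem infinite_deriv_ne_zero {U : TopologicalSpace.Opens ℝ} {f : ℝ → ℝ}
    (hf : ContDiffOn ℝ ∞ f U) (h : ∃ t₀ : U, deriv f t₀ ≠ 0) :
    Infinite {t : U // deriv f t ≠ 0} := by
  obtain ⟨t₀, ht₀⟩ := h
  have hc : ContinuousOn (deriv f) U := hf.continuousOn_deriv_of_isOpen U.isOpen (by simp)
  have hmem : (U : Set ℝ) ∩ deriv f ⁻¹' {0}ᶜ ∈ nhds (t₀ : ℝ) :=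
    (hc.isOpen_inter_preimage U.isOpen isOpen_compl_singleton).mem_nhds ⟨t₀.2, ht₀⟩
  have hinf := infinite_of_mem_nhds (t₀ : ℝ) hmem
  have : Infinite ↥((U : Set ℝ) ∩ deriv f ⁻¹' {0}ᶜ) := hinf.to_subtype
  exact Infinite.of_injective
    (fun t : ↥((U : Set ℝ) ∩ deriv f ⁻¹' {0}ᶜ) =>
      (⟨⟨t, t.2.1⟩, t.2.2⟩ : {t : U // deriv f t ≠ 0}))
    fun s t hst => Subtype.ext (congrArg (fun x : {t : U // deriv f t ≠ 0} => (x.1 : ℝ)) hst)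

end

theorem mainTheorem5 (U : TopologicalSpace.Opens ℝ) (hU : IsPreconnected (U : Set ℝ))
    (f : ℝ → ℝ) (hf : ContDiffOn ℝ ∞ f U) (hpos : ∀ t ∈ U, 0 < f t)
    (hconst : ¬ ∃ k : ℝ, ∀ t ∈ U, f t = k) :
    -- levels `t₀` with `f' t₀ ≠ 0` and circles of any geodesic curvature exist
    (∃ t₀ : U, deriv f t₀ ≠ 0) ∧
    (∀ c : ℝ, ∃ γ : ℝ → CR, IsCircleOfGeodesicCurvature γ c) ∧
    -- the causal type of the Hopf lift of a circle of geodesic curvature `c` at such a level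
    (∀ t₀ : U, deriv f t₀ ≠ 0 → ∀ (c : ℝ) (γ : ℝ → CR), IsCircleOfGeodesicCurvature γ c →
      (c = 2 * |deriv f t₀| →
        IsMarginallyTrappedTorus (flrwMetric U f hf hpos) (hopfLift t₀ (range γ))) ∧
      (2 * |deriv f t₀| < c →
        IsUntrappedTorus (flrwMetric U f hf hpos) (hopfLift t₀ (range γ))) ∧
      (|deriv f t₀| < c → c < 2 * |deriv f t₀| →
        IsTrappedTorus (flrwMetric U f hf hpos) (hopfLift t₀ (range γ)))) ∧
    -- there are infinitely many such tori of each kind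
    {T : Set (U × S3) | IsMarginallyTrappedTorus (flrwMetric U f hf hpos) T ∧
      ∃ (t₀ : U) (γ : ℝ → CR), deriv f t₀ ≠ 0 ∧
        IsCircleOfGeodesicCurvature γ (2 * |deriv f t₀|) ∧ T = hopfLift t₀ (range γ)}.Infinite ∧
    {T : Set (U × S3) | IsUntrappedTorus (flrwMetric U f hf hpos) T ∧
      ∃ (t₀ : U) (c : ℝ) (γ : ℝ → CR), deriv f t₀ ≠ 0 ∧ 2 * |deriv f t₀| < c ∧
        IsCircleOfGeodesicCurvature γ c ∧ T = hopfLift t₀ (range γ)}.Infinite ∧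
    {T : Set (U × S3) | IsTrappedTorus (flrwMetric U f hf hpos) T ∧
      ∃ (t₀ : U) (c : ℝ) (γ : ℝ → CR), deriv f t₀ ≠ 0 ∧ |deriv f t₀| < c ∧
        c < 2 * |deriv f t₀| ∧ IsCircleOfGeodesicCurvature γ c ∧
        T = hopfLift t₀ (range γ)}.Infinite := by
  have hex := exists_deriv_ne_zero_of_not_const hU hf hconst
  have hinf := infinite_deriv_ne_zero hf hex
  -- One circle of curvature `a |f'(t)|` is chosen at each admissible level `t`. The values `a = 2`,
  -- `3` and `3/2` realize the marginally trapped, untrapped and trapped ranges.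
  have hinj : ∀ a : ℝ, ∃ γ : {t : U // deriv f t ≠ 0} → ℝ → CR,
      (∀ t, IsCircleOfGeodesicCurvature (γ t) (a * |deriv f t.1|)) ∧
      Function.Injective fun t => hopfLift t.1 (range (γ t)) := by
    intro a
    choose γ hγ using fun t : {t : U // deriv f t ≠ 0} =>
      exists_isCircleOfGeodesicCurvature (a * |deriv f t.1|)
    exact ⟨γ, hγ, injective_hopfLift Subtype.val_injective hγ⟩
  refine ⟨hex, exists_isCircleOfGeodesicCurvature, fun t₀ ht₀ c γ hγ =>
    ⟨isMarginallyTrappedTorus_hopfLift hf hpos t₀ ht₀ hγ,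
      isUntrappedTorus_hopfLift hf hpos t₀ ht₀ hγ,
      fun hc => isTrappedTorus_hopfLift hf hpos t₀ ht₀ hγ ((abs_nonneg _).trans hc.le)⟩, ?_, ?_, ?_⟩
  · obtain ⟨γ, hγ, hi⟩ := hinj 2
    refine infinite_of_injective_forall_mem hi fun t => ?_
    exact ⟨isMarginallyTrappedTorus_hopfLift hf hpos t.1 t.2 (hγ t) rfl, t.1, γ t, t.2, hγ t, rfl⟩
  · obtain ⟨γ, hγ, hi⟩ := hinj 3
    refine infinite_of_injective_forall_mem hi fun t => ?_
    have h := abs_pos.2 t.2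
    have hc : 2 * |deriv f t.1| < 3 * |deriv f t.1| := by linarith
    exact ⟨isUntrappedTorus_hopfLift hf hpos t.1 t.2 (hγ t) hc, t.1, _, γ t, t.2, hc, hγ t, rfl⟩
  · obtain ⟨γ, hγ, hi⟩ := hinj (3 / 2)
    refine infinite_of_injective_forall_mem hi fun t => ?_
    have h := abs_pos.2 t.2
    have hc : 3 / 2 * |deriv f t.1| < 2 * |deriv f t.1| := by linarith
    exact ⟨isTrappedTorus_hopfLift hf hpos t.1 t.2 (hγ t) (by positivity) hc, t.1, _, γ t, t.2,
      by linarith, hc, hγ t, rfl⟩
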